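/- **Convergence of the relaxation deferred correction (RDeC) method.** Let $d>1$, $M=d-1$, $K=d$, let $0=\beta^0<\beta^1<\dots<\beta^M=1$ be nodes with Lagrange polynomials $\varphi_0,\dots,\varphi_M$, and put $\theta_r^m=\int_0^{\beta^m}\varphi_r(s)\,ds$. Let $E$ be a finite-dimensional real inner product space, let $f:\mathbb R\times E\to E$ be of class $C^d$, and let $y:[t_0,T]\to E$, $t_0<T$, solve $y'(t)=f(t,y(t))$, $y(t_0)=y_0$. Assume that $f$ does not depend on $t$, or that $f(t,y(t))\neq 0$ for all $t\in[t_0,T]$. For a start value $y^n$ at time $t^n$ and a step size $\Delta t>0$, put $t^{m,(k)}=t^n+\beta^m\Delta t$ for $k\ge 1$ and $t^{m,(0)}=t^n$, write $f^{r,(k)}=f(t^{r,(k)},y^{r,(k)})$ for states $\mathbf y^{(k)}=(y^{0,(k)},\dots,y^{M,(k)})$, and define, for $m=1,\dots,M$, $$\mathcal L^{1}(\mathbf y^{(k)})_m=y^{m,(k)}-y^{0,(k)}-\beta^m\Delta t\,f^{0,(k)},\qquad \mathcal L^{2}(\mathbf y^{(k)})_m=y^{m,(k)}-y^{0,(k)}-\Delta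 t\sum_{r=0}^M\theta^m_r f^{r,(k)};$$ let $\mathcal L^2_\gamma$ be $\mathcal L^2$ with $\Delta t$ replaced by $\gamma\Delta t$ in the component $m=M$. An RDeC step is given by $$y^{0,(k)}=y^n,\quad y^{m,(0)}=y^n,\quad \mathcal L^1(\mathbf y^{(k)})=\mathcal L^1(\mathbf y^{(k-1)})-\mathcal L^2(\mathbf y^{(k-1)})\ (1\le k<K),$$ $$\mathcal L^1(\mathbf y^{(K)})=\mathcal L^1(\mathbf y^{(K-1)})-\mathcal L^2_{\gamma_n}(\mathbf y^{(K-1)}),\qquad y^{n+1}=y^{M,(K)},\qquad t^{n+1}=t^n+\gamma_n\Delta t.$$ Here $\gamma_n=\dfrac{2\sum_{i,j}b_ia_{ij}\langle f_i,f_j\rangle}{\sum_{i,j}b_ib_j\langle f_i,f_j\rangle}$ if $\sum_i b_if_i\ne0$ and $\gamma_n=1$ otherwise, where $(a_{ij}),(b_i)$ is the Butcher tableau of the DeC method, written as a Runge--Kutta method: its stages are $y^n$ and $y^{m,(k)}$ ($1\le m\le M$, $1\le k\le K-1$), with stage derivatives $f_i$ equal to $f(t^n,y^n)$ and $f^{m,(k)}$;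 the row of $y^n$ is zero; the row of $y^{m,(1)}$ has the only entry $\beta^m$, in the column of $y^n$; for $k\ge2$ the row of $y^{m,(k)}$ has $\theta_0^m$ in the column of $y^n$, $\theta^m_r$ in the columns of $y^{r,(k-1)}$, $r\ge1$, and zeros elsewhere; the weights $b$ are $\theta^M_0$ for $y^n$, $\theta^M_r$ for $y^{r,(K-1)}$, $r\ge 1$, and zero elsewhere. Then the RDeC method has order of accuracy $d$, with $y^{n+1}$ read as an approximation of $y(t^n+\gamma_n\Delta t)$. That is, there are $C,h_0>0$ such that: 1. (one step) if $t^n\in[t_0,T]$, $y^n=y(t^n)$ and $0<\Delta t\le h_0$, then $|\gamma_n-1|\le C\Delta t^{d-1}$, and $\|y^{n+1}-y(t^n+\gamma_n\Delta t)\|\le C\Delta t^{d+1}$ if $t^n+\gamma_n\Delta t\le T$; 2. (many steps) if $0<h\le h_0$ and the method is started with $t^0=t_0$, $y^0=y_0$ and run with step sizes $0<\Delta t_n\le h$, then $|\gamma_n-1|\le C\Delta t_n^{d-1}$ and $\|y^n-y(t^n)\|\le Ch^d$ for all $n$ with $t^k\le T$ for every $k\le n$. -/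

import Mathlib

/-! Relaxation deferred correction (RDeC) for `y' = f(t, y)`.

The time step `[t, t + Δt]` is subdivided by the nodes `t + β m * Δt`, `m = 0, …, M`, where
`0 = β 0 < β 1 < ⋯ < β M = 1`. -/

noncomputable section

namespace RDeC

/-- `θ_r^m = ∫_0^{β m} φ_r`, where `φ_r` is the `r`-th Lagrange polynomial of the nodes `β`. -/
def theta {M : ℕ} (β : Fin (M + 1) → ℝ) (r m : Fin (M + 1)) : ℝ :=
  ∫ s in (0 : ℝ)..(β m), (Lagrange.basis Finset.univ β r).eval s

/-- The times at which the substates of the `k`-th iterate are evaluated: the initial guess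
`y^{m,(0)} = y^n` is attached to the time `t^n`, the later iterates `y^{m,(k)}` to the
subtimestep `t^n + β m * Δt`.
(For `f` independent of the time these play no role.) -/
def substepTime {M : ℕ} (β : Fin (M + 1) → ℝ) (t Δt : ℝ) (k : ℕ) (m : Fin (M + 1)) : ℝ :=
  if k = 0 then t else t + β m * Δt

section Operators

variable {E : Type*} [NormedAddCommGroup E] [InnerProductSpace ℝ E] {M : ℕ}

/-- The low order operator `L¹` (explicit Euler); the component `m` belongs to `y^{m+1}`.
`τ` are the times and `Y = (y^0, …, y^M)` the states of the substeps. -/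
def opL1 (β : Fin (M + 1) → ℝ) (f : ℝ → E → E) (Δt : ℝ) (τ : Fin (M + 1) → ℝ)
    (Y : Fin (M + 1) → E) : Fin M → E :=
  fun m => Y m.succ - Y 0 - (β m.succ * Δt) • f (τ 0) (Y 0)

/-- The high order operator `L²`. -/
def opL2 (β : Fin (M + 1) → ℝ) (f : ℝ → E → E) (Δt : ℝ) (τ : Fin (M + 1) → ℝ)
    (Y : Fin (M + 1) → E) : Fin M → E :=
  fun m => Y m.succ - Y 0 - Δt • ∑ r, theta β r m.succ • f (τ r) (Y r)

/-- The relaxed operator `L²_γ`: in the equation of `y^M`, `Δt` is multiplied by `γ`. -/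
def opL2Relaxed (γ : ℝ) (β : Fin (M + 1) → ℝ) (f : ℝ → E → E) (Δt : ℝ) (τ : Fin (M + 1) → ℝ)
    (Y : Fin (M + 1) → E) : Fin M → E :=
  fun m => Y m.succ - Y 0 -
    ((if m.succ = Fin.last M then γ else 1) * Δt) • ∑ r, theta β r m.succ • f (τ r) (Y r)

open Classical in
/-- The relaxation coefficient of a Runge-Kutta method with coefficients `A`, `b` and stage
derivatives `F`. -/
def relaxationCoeff {ι : Type*} [Fintype ι] (A : ι → ι → ℝ) (b : ι → ℝ) (F : ι → E) : ℝ :=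
  if ‖∑ i, b i • F i‖ ^ 2 ≠ 0 then
    (2 * ∑ i, ∑ j, b i * A i j * inner ℝ (F i) (F j)) /
      ∑ i, ∑ j, b i * b j * inner ℝ (F i) (F j)
  else 1

/-- The stages of the Runge-Kutta form of DeC with `K` corrections: `none` is the stage `y^n`,
and `some (k, m)` is the stage `y^{m+1,(k+1)}`, for the corrections before the last one. -/
abbrev Stage (K M : ℕ) : Type := Option (Fin (K - 1) × Fin M)

/-- The matrix of the Butcher tableau of DeC. -/
def butcherA (K : ℕ) (β : Fin (M + 1) → ℝ) : Stage K M → Stage K M → ℝ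
  | none, _ => 0
  | some (k, m), none => if (k : ℕ) = 0 then β m.succ else theta β 0 m.succ
  | some (k, m), some (l, r) => if (l : ℕ) + 1 = k then theta β r.succ m.succ else 0

/-- The weights of the Butcher tableau of DeC (nonzero only for `y^n` and the last block). -/
def butcherB (K : ℕ) (β : Fin (M + 1) → ℝ) : Stage K M → ℝ
  | none => theta β 0 (Fin.last M)
  | some (k, r) => if (k : ℕ) + 2 = K then theta β r.succ (Fin.last M) else 0

/-- The abscissae of the Butcher tableau of DeC. -/
def butcherC (K : ℕ) (β : Fin (M + 1) → ℝ) : Stage K M → ℝ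
  | none => 0
  | some (_, m) => β m.succ

/-- The stage values of DeC, read off from the start value `y` and the iterates `Y k m`. -/
def stageValue (K : ℕ) (y : E) (Y : ℕ → Fin (M + 1) → E) : Stage K M → E
  | none => y
  | some (k, m) => Y (k + 1) m.succ

/-- The relaxation coefficient of a DeC step from `(t, y)` with step size `Δt`. -/
def gammaDeC (K : ℕ) (β : Fin (M + 1) → ℝ) (f : ℝ → E → E) (t Δt : ℝ) (y : E)
    (Y : ℕ → Fin (M + 1) → E) : ℝ :=
  relaxationCoeff (butcherA K β) (butcherB K β)
    (fun i => f (t + butcherC K β i * Δt) (stageValue K y Y i))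

/-- `Y k m = y^{m,(k)}`, `k = 0, …, K`, are the iterates of one RDeC step with `K` corrections,
start `(t, y)`, step size `Δt` and relaxation coefficient `γ`. The relaxed operator is used in
the last correction. The new value is `Y K (Fin.last M)`, at the new time `t + γ * Δt`. -/
structure IsRDeCStep (K : ℕ) (β : Fin (M + 1) → ℝ) (f : ℝ → E → E) (t Δt : ℝ) (y : E)
    (Y : ℕ → Fin (M + 1) → E) (γ : ℝ) : Prop where
  start : ∀ k ≤ K, Y k 0 = y
  init : ∀ m, Y 0 m = y
  correction : ∀ k, k + 1 < K →
    opL1 β f Δt (substepTime β t Δt (k + 1)) (Y (k + 1)) =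
      opL1 β f Δt (substepTime β t Δt k) (Y k) - opL2 β f Δt (substepTime β t Δt k) (Y k)
  gamma_eq : γ = gammaDeC K β f t Δt y Y
  last_correction :
    opL1 β f Δt (substepTime β t Δt K) (Y K) =
      opL1 β f Δt (substepTime β t Δt (K - 1)) (Y (K - 1)) -
        opL2Relaxed γ β f Δt (substepTime β t Δt (K - 1)) (Y (K - 1))

/-- An RDeC approximation of `y' = f(t, y)`, `y(t₀) = y₀`: values `y n` at times `t n`, obtained
with step sizes `Δt n` and relaxation coefficients `γ n`, where `y (n + 1)` is attached to the
time `t (n + 1) = t n + γ n * Δt n`. -/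
def IsRDeCRun (K : ℕ) (β : Fin (M + 1) → ℝ) (f : ℝ → E → E) (t₀ : ℝ) (y₀ : E)
    (Δt t γ : ℕ → ℝ) (y : ℕ → E) : Prop :=
  t 0 = t₀ ∧ y 0 = y₀ ∧
    ∀ n, t (n + 1) = t n + γ n * Δt n ∧
      ∃ Y, IsRDeCStep K β f (t n) (Δt n) (y n) Y (γ n) ∧ y (n + 1) = Y K (Fin.last M)

end Operators

end RDeC

end

noncomputable section

namespace RDeC

open Set Metric

/-! Write `d = N + 2`. Eliminating the Euler terms turns each correction into a Picard iteration
with the integral replaced by interpolatory quadrature (`IsRDeCStep.iterate_succ`). Each iteration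
gains one power of `Δt` until the quadrature order is reached, so the last stages have error of
order `N + 2`, and the unrelaxed update `y + Δt S` has error of order `N + 3`
(`exists_stage_error_bound`, `exists_unrelaxed_error_bound`).

The point is that `γ` is close to `1`. The stage equations turn the numerator of `γ` into the same
quadrature applied to `2⟨u, f⟩ = (‖u‖²)'`. Hence `(γ - 1) ‖S‖² Δt²` is the difference of two errors:
that of `‖y + Δt S‖²` and that of the quadrature for the increment of `‖u‖²`. Both are of order `N +
3`; since `S` is close to `f t y`, which is bounded away from zero, division gives `γ - 1 = O(Δt ^
(N + 1))` (`exists_gamma_bound`). Replacing `Δt` by `γ Δt` in both the update and the time costs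
only `|γ - 1| Δt²`, as the solution is affine to second order (`norm_sol_relaxed_sub_le`).

For many steps, the local errors are measured against the exact solution through the current
numerical value and transported by Gronwall (`exists_error_recursion`, `error_le_of_recursion`). The
sum closes because `γ ≥ 1/2` bounds the step size by twice the time advance, and a small `h` keeps
the error in the tube where `f` does not vanish.

If `f` does vanish somewhere on the solution, then `f` is autonomous, the solution is an equilibrium
by uniqueness, and the method reproduces it exactly. -/

/-- `u` solves `u' = f(s, u)` on `[a, b]`, and its graph stays in `D`. -/
structure SolvesIn {E : Type*} [NormedAddCommGroup E] [NormedSpace ℝ E] (f : ℝ → E → E)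
    (D : Set (ℝ × E)) (a b : ℝ) (u : ℝ → E) : Prop where
  mem : ∀ s ∈ Icc a b, (s, u s) ∈ D
  deriv : ∀ s ∈ Icc a b, HasDerivWithinAt u (f s (u s)) (Icc a b) s

/-! ### Solutions in a compact region: uniform Taylor expansion and local existence. -/

section Flow

variable {E : Type*} [NormedAddCommGroup E] [NormedSpace ℝ E] {f : ℝ → E → E} {D : Set (ℝ × E)}

/-- The derivative of `G` along the solutions of `u' = f(s, u)`. -/
def lieDeriv {F : Type*} [NormedAddCommGroup F] [NormedSpace ℝ F] (f : ℝ → E → E)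
    (G : ℝ × E → F) (p : ℝ × E) : F :=
  fderiv ℝ G p (1, f p.1 p.2)

lemma contDiff_lieDeriv {F : Type*} [NormedAddCommGroup F] [NormedSpace ℝ F] {G : ℝ × E → F}
    {n : ℕ} (hf : ContDiff ℝ n (fun p : ℝ × E => f p.1 p.2)) (hG : ContDiff ℝ (n + 1 : ℕ) G) :
    ContDiff ℝ n (lieDeriv f G) := by
  have h : ContDiff ℝ n (fderiv ℝ G) := hG.fderiv_right (by norm_cast)
  exact h.clm_apply (contDiff_const.prodMk hf)

lemma SolvesIn.hasDerivWithinAt_comp {F : Type*} [NormedAddCommGroup F] [NormedSpace ℝ F]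
    {a b : ℝ} {u : ℝ → E} (hu : SolvesIn f D a b u) {G : ℝ × E → F} (hG : Differentiable ℝ G)
    {s : ℝ} (hs : s ∈ Icc a b) :
    HasDerivWithinAt (fun s => G (s, u s)) (lieDeriv f G (s, u s)) (Icc a b) s :=
  (hG (s, u s)).hasFDerivAt.comp_hasDerivWithinAt s
    ((hasDerivWithinAt_id s _).prodMk (hu.deriv s hs))

/-- Termwise antiderivative of the Taylor polynomial, normalised to vanish at `t`; it serves both
the expansion and the quadrature error. -/
lemma hasDerivAt_shift_pow {F : Type*} [NormedAddCommGroup F] [NormedSpace ℝ F]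
    (n : ℕ) (c : ℕ → F) (t s : ℝ) :
    HasDerivAt (fun s => ∑ i ∈ Finset.range n, (s - t) ^ (i + 1) • ((i + 1 : ℝ)⁻¹ • c i))
      (∑ i ∈ Finset.range n, (s - t) ^ i • c i) s := by
  refine HasDerivAt.fun_sum fun i _ => ?_
  have h := ((((hasDerivAt_id s).sub_const t).pow (i + 1)).smul_const ((i + 1 : ℝ)⁻¹ • c i))
  refine h.congr_deriv ?_
  have : (i + 1 : ℝ) ≠ 0 := by positivity
  rw [smul_smul]
  congr 1
  simp
  field_simp

/-- Taylor expansion of order `n`, uniform in the solutions that stay in a compact set. -/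
theorem exists_expansion {F : Type*} [NormedAddCommGroup F] [NormedSpace ℝ F]
    (hD : IsCompact D) (n : ℕ) (hf : ContDiff ℝ n (fun p : ℝ × E => f p.1 p.2)) (G : ℝ × E → F)
    (hG : ContDiff ℝ n G) :
    ∃ C ≥ 0, ∀ a b u, SolvesIn f D a b u → ∃ c : ℕ → F, ∀ s ∈ Icc a b,
      ‖G (s, u s) - ∑ i ∈ Finset.range n, (s - a) ^ i • c i‖ ≤ C * (s - a) ^ n := by
  induction n generalizing G with
  | zero =>
    obtain ⟨C, hC⟩ := hD.exists_bound_of_continuousOn hG.continuous.continuousOn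
    refine ⟨max C 0, le_max_right _ _, fun a b u hu => ⟨0, fun s hs => ?_⟩⟩
    simpa using Or.inl (hC _ (hu.mem s hs))
  | succ n ih =>
    have hf' : ContDiff ℝ n (fun p : ℝ × E => f p.1 p.2) := hf.of_le (by norm_cast; omega)
    -- Expand the derivative of `G` along the flow, which is one order less smooth, and integrate.
    -- The constant depends only on `D` and is not changed by the integration.
    obtain ⟨C, hC0, hC⟩ := ih hf' _ (contDiff_lieDeriv hf' hG)
    refine ⟨C, hC0, fun a b u hu => ?_⟩
    obtain ⟨c, hc⟩ := hC a b u hu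
    refine ⟨fun i => if i = 0 then G (a, u a) else (i : ℝ)⁻¹ • c (i - 1), fun s hs => ?_⟩
    have hd : ∀ x ∈ Icc a s, HasDerivWithinAt
        (fun s => G (s, u s) -
          ∑ i ∈ Finset.range n, (s - a) ^ (i + 1) • ((i + 1 : ℝ)⁻¹ • c i))
        (lieDeriv f G (x, u x) - ∑ i ∈ Finset.range n, (x - a) ^ i • c i) (Icc a s) x :=
      fun x hx => ((hu.hasDerivWithinAt_comp (hG.differentiable (by norm_cast))
        ⟨hx.1, hx.2.trans hs.2⟩).mono (Icc_subset_Icc_right hs.2)).sub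
          (hasDerivAt_shift_pow n c a x).hasDerivWithinAt
    -- The mean value inequality stands in for the integral, so `F` need not be complete.
    have := norm_image_sub_le_of_norm_deriv_le_segment' hd (C := C * (s - a) ^ n)
      (fun x hx => (hc x ⟨hx.1, hx.2.le.trans hs.2⟩).trans (by
        have := hx.1; have := hx.2
        gcongr)) s (right_mem_Icc.2 hs.1)
    rw [Finset.sum_range_succ']
    simp only [sub_self, ne_eq, Nat.add_eq_zero_iff, one_ne_zero, and_false, not_false_eq_true,
      zero_pow, zero_smul, Finset.sum_const_zero, sub_zero] at this
    simp only [Nat.add_eq_zero_iff, one_ne_zero, and_false, if_false, pow_zero, one_smul, if_true,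
      Nat.add_sub_cancel, Nat.cast_add, Nat.cast_one]
    rw [pow_succ, ← mul_assoc, ← sub_sub]
    exact this

/-- The Picard-Lindelöf theorem, with the information that the solution stays in the ball. -/
theorem exists_solution_mem_closedBall_of_isPicardLindelof [CompleteSpace E] {a b : ℝ}
    {t₀ : Icc a b} {y : E} {ρ r B K : NNReal} (hf : IsPicardLindelof f t₀ y ρ r B K) :
    ∃ u : ℝ → E, u t₀ = y ∧ SolvesIn f (Icc a b ×ˢ closedBall y ρ) a b u := by
  have hy : y ∈ closedBall y (r : ℝ) := mem_closedBall_self r.2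
  obtain ⟨α, hα⟩ := ODE.FunSpace.exists_isFixedPt_next hf hy
  refine ⟨α.compProj, by rw [ODE.FunSpace.compProj_val, ← hα, ODE.FunSpace.next_apply₀],
    fun s hs => ⟨hs, α.compProj_mem_closedBall hf.mul_max_le⟩, fun s hs => ?_⟩
  apply ODE.hasDerivWithinAt_picard_Icc t₀.2 hf.continuousOn_uncurry
    α.continuous_compProj.continuousOn (fun _ _ ↦ α.compProj_mem_closedBall hf.mul_max_le)
    y hs |>.congr_of_mem _ hs
  intro t' ht'
  nth_rw 1 [← hα]
  rw [ODE.FunSpace.compProj_of_mem ht', ODE.FunSpace.next_apply]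

/-- Local existence for a vector field that is bounded by `B` and Lipschitz continuous on a ball,
with the solution remaining in that ball. -/
theorem exists_solution_mem_closedBall [CompleteSpace E] (hf : Continuous fun p : ℝ × E => f p.1 p.2)
    {a b : ℝ} {ρ B K : NNReal} (hab : a ≤ b) (y : E)
    (hK : ∀ s ∈ Icc a b, LipschitzOnWith K (f s) (closedBall y ρ))
    (hb : ∀ s ∈ Icc a b, ∀ x ∈ closedBall y ρ, ‖f s x‖ ≤ B) (hle : B * (b - a) ≤ ρ) :
    ∃ u : ℝ → E, u a = y ∧ SolvesIn f (Icc a b ×ˢ closedBall y ρ) a b u :=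
  exists_solution_mem_closedBall_of_isPicardLindelof (t₀ := ⟨a, left_mem_Icc.2 hab⟩) (r := 0)
    { lipschitzOnWith := hK
      continuousOn := fun x _ =>
        (hf.comp (by fun_prop : Continuous fun s : ℝ => (s, x))).continuousOn
      norm_le := hb
      mul_max_le := by
        rw [sub_self, max_eq_left (sub_nonneg.2 hab), NNReal.coe_zero, sub_zero]
        exact hle }

end Flow

/-! ### Exactness and error of the interpolatory quadrature. -/

section Quadrature

variable {M : ℕ} {β : Fin (M + 1) → ℝ}

@[simp]
lemma theta_zero_right (hβ0 : β 0 = 0) (r : Fin (M + 1)) : theta β r 0 = 0 := by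
  simp [theta, hβ0]

/-- The quadrature rule with the weights `theta` is exact for polynomials of degree at most `M`. -/
theorem sum_theta_mul_pow (hβ : Function.Injective β) (m : Fin (M + 1)) {i : ℕ} (hi : i ≤ M) :
    ∑ r, theta β r m * β r ^ i = β m ^ (i + 1) / (i + 1) := by
  have hp : ((Polynomial.X : Polynomial ℝ) ^ i) = Lagrange.interpolate Finset.univ β
      (fun r => ((Polynomial.X : Polynomial ℝ) ^ i).eval (β r)) := by
    refine Lagrange.eq_interpolate hβ.injOn ?_
    rw [Polynomial.degree_X_pow, Finset.card_univ, Fintype.card_fin]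
    exact_mod_cast Nat.lt_succ_of_le hi
  have hs : ∀ s : ℝ, s ^ i = ∑ r, β r ^ i * (Lagrange.basis Finset.univ β r).eval s := by
    intro s
    have := congrArg (Polynomial.eval s) hp
    simpa [Lagrange.interpolate_apply, Polynomial.eval_finsetSum] using this
  have hint : ∫ s in (0 : ℝ)..(β m), s ^ i = β m ^ (i + 1) / (i + 1) := by
    rw [integral_pow]; simp
  rw [← hint]
  rw [funext hs]
  rw [intervalIntegral.integral_finsetSum]
  · simp_rw [intervalIntegral.integral_const_mul, theta, mul_comm]
  · intro r _
    exact (by fun_prop : Continuous fun s =>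
      β r ^ i * (Lagrange.basis Finset.univ β r).eval s).intervalIntegrable _ _

lemma sum_theta (hβ : Function.Injective β) (m : Fin (M + 1)) : ∑ r, theta β r m = β m := by
  simpa using sum_theta_mul_pow hβ m (Nat.zero_le M)

lemma node_mem_Icc (hβ : StrictMono β) (hβ0 : β 0 = 0) (hβ1 : β (Fin.last M) = 1)
    (r : Fin (M + 1)) : β r ∈ Icc (0 : ℝ) 1 :=
  ⟨hβ0 ▸ hβ.monotone (Fin.zero_le r), hβ1 ▸ hβ.monotone (Fin.le_last r)⟩

lemma add_node_mul_mem_Icc (hβ : StrictMono β) (hβ0 : β 0 = 0) (hβ1 : β (Fin.last M) = 1)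
    (r : Fin (M + 1)) {t Δt : ℝ} (hΔ : 0 ≤ Δt) : t + β r * Δt ∈ Icc t (t + Δt) := by
  obtain ⟨h0, h1⟩ := node_mem_Icc hβ hβ0 hβ1 r
  constructor <;> nlinarith

/-- Error of the quadrature rule for the integral `Q (t + β m * Δt) - Q t` of `g`, when `g` is a
polynomial of degree at most `M` up to a remainder of order `M + 1`. -/
theorem norm_quadrature_error_le {F : Type*} [NormedAddCommGroup F] [NormedSpace ℝ F]
    (hβ : StrictMono β) (hβ0 : β 0 = 0) (hβ1 : β (Fin.last M) = 1) (m : Fin (M + 1))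
    {g Q : ℝ → F} {c : ℕ → F} {t Δt C : ℝ} (hΔ : 0 ≤ Δt) (hC : 0 ≤ C)
    (hQ : ∀ s ∈ Icc t (t + Δt), HasDerivWithinAt Q (g s) (Icc t (t + Δt)) s)
    (hg : ∀ s ∈ Icc t (t + Δt),
      ‖g s - ∑ i ∈ Finset.range (M + 1), (s - t) ^ i • c i‖ ≤ C * (s - t) ^ (M + 1)) :
    ‖Q (t + β m * Δt) - Q t - Δt • ∑ r, theta β r m • g (t + β r * Δt)‖ ≤
      (1 + ∑ r, |theta β r m|) * C * Δt ^ (M + 2) := by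
  set P : ℝ → F := fun s => ∑ i ∈ Finset.range (M + 1), (s - t) ^ (i + 1) • ((i + 1 : ℝ)⁻¹ • c i)
  set p : ℝ → F := fun s => ∑ i ∈ Finset.range (M + 1), (s - t) ^ i • c i
  have hle : ∀ s ∈ Icc t (t + Δt), C * (s - t) ^ (M + 1) ≤ C * Δt ^ (M + 1) := by
    intro s hs
    have h1 := hs.1
    have h2 := hs.2
    have : s - t ≤ Δt := by linarith
    have : 0 ≤ s - t := by linarith
    gcongr
  have h1 : ‖(Q (t + β m * Δt) - P (t + β m * Δt)) - (Q t - P t)‖ ≤ C * Δt ^ (M + 1) * Δt := by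
    have hm := add_node_mul_mem_Icc hβ hβ0 hβ1 m (t := t) hΔ
    refine (norm_image_sub_le_of_norm_deriv_le_segment' (f := fun s => Q s - P s)
      (f' := fun s => g s - p s) (C := C * Δt ^ (M + 1))
      (fun s hs => (hQ s hs).sub (hasDerivAt_shift_pow (M + 1) c t s).hasDerivWithinAt)
      (fun s hs => (hg s (Ico_subset_Icc_self hs)).trans (hle s (Ico_subset_Icc_self hs)))
      _ hm).trans ?_
    have : t + β m * Δt - t ≤ Δt := by linarith [hm.2]
    gcongr
  have hPt : P t = 0 := by simp [P]
  -- The polynomial part is integrated without error, so only the two remainder terms `h1` and `h2`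
  -- survive.
  have hex : P (t + β m * Δt) = Δt • ∑ r, theta β r m • p (t + β r * Δt) := by
    simp only [P, p, add_sub_cancel_left, Finset.smul_sum]
    rw [Finset.sum_comm]
    refine Finset.sum_congr rfl fun i hi => ?_
    simp only [smul_smul]
    rw [← Finset.sum_smul]
    congr 1
    have := sum_theta_mul_pow hβ.injective m (Nat.lt_succ_iff.1 (Finset.mem_range.1 hi))
    calc (β m * Δt) ^ (i + 1) * (i + 1 : ℝ)⁻¹ = Δt ^ (i + 1) * (β m ^ (i + 1) / (i + 1)) := by
          rw [mul_pow]; ring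
      _ = ∑ r, Δt * (theta β r m * (β r * Δt) ^ i) := by
          rw [← this, Finset.mul_sum]
          exact Finset.sum_congr rfl fun r _ => by rw [mul_pow]; ring
  have h2 : ‖Δt • ∑ r, theta β r m • (g (t + β r * Δt) - p (t + β r * Δt))‖ ≤
      Δt * ((∑ r, |theta β r m|) * (C * Δt ^ (M + 1))) := by
    rw [norm_smul, Real.norm_of_nonneg hΔ, Finset.sum_mul]
    gcongr
    refine norm_sum_le_of_le _ fun r _ => ?_
    rw [norm_smul, Real.norm_eq_abs]
    have hr := add_node_mul_mem_Icc hβ hβ0 hβ1 r (t := t) hΔ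
    gcongr
    exact (hg _ hr).trans (hle _ hr)
  calc ‖Q (t + β m * Δt) - Q t - Δt • ∑ r, theta β r m • g (t + β r * Δt)‖
      = ‖((Q (t + β m * Δt) - P (t + β m * Δt)) - (Q t - P t)) -
          Δt • ∑ r, theta β r m • (g (t + β r * Δt) - p (t + β r * Δt))‖ := by
        rw [hPt, hex]
        simp only [smul_sub, Finset.sum_sub_distrib]
        congr 1
        abel
    _ ≤ C * Δt ^ (M + 1) * Δt + Δt * ((∑ r, |theta β r m|) * (C * Δt ^ (M + 1))) :=
        (norm_sub_le _ _).trans (add_le_add h1 h2)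
    _ = (1 + ∑ r, |theta β r m|) * C * Δt ^ (M + 2) := by ring

end Quadrature

/-! ### Algebra of one step: Picard form, Butcher form, relaxation coefficient. -/

section Step

variable {E : Type*} [NormedAddCommGroup E] [InnerProductSpace ℝ E] {M K : ℕ}
  {β : Fin (M + 1) → ℝ} {f : ℝ → E → E} {t Δt γ : ℝ} {y : E} {Y : ℕ → Fin (M + 1) → E}

@[simp]
lemma substepTime_zero_right (hβ0 : β 0 = 0) (k : ℕ) : substepTime β t Δt k 0 = t := by
  simp [substepTime, hβ0]

/-- One correction is a Picard iteration with the quadrature rule in place of the integral. -/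
theorem IsRDeCStep.iterate_succ (h : IsRDeCStep K β f t Δt y Y γ) (hβ0 : β 0 = 0) {k : ℕ}
    (hk : k + 1 < K) (m : Fin (M + 1)) :
    Y (k + 1) m = y + Δt • ∑ r, theta β r m • f (substepTime β t Δt k r) (Y k r) := by
  refine Fin.cases ?_ (fun m => ?_) m
  · simp [h.start (k + 1) hk.le, hβ0]
  · have := congrFun (h.correction k hk) m
    simp only [opL1, opL2, Pi.sub_apply, substepTime_zero_right hβ0, h.start (k + 1) hk.le,
      h.start k (by omega)] at this
    rw [sub_sub, sub_eq_iff_eq_add] at this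
    rw [this]
    abel

/-- The Euler terms of `opL1` cancel because all iterates agree at the node `0`. With `K + 2`
corrections the penultimate iterate has positive index, so its stages carry the subtimestep times.
-/
theorem IsRDeCStep.final_eq (h : IsRDeCStep (K + 2) β f t Δt y Y γ) (hβ0 : β 0 = 0)
    (hM : M ≠ 0) :
    Y (K + 2) (Fin.last M) = y + (γ * Δt) •
      ∑ r, theta β r (Fin.last M) • f (t + β r * Δt) (Y (K + 1) r) := by
  obtain ⟨m, hm⟩ : ∃ m : Fin M, m.succ = Fin.last M := by
    refine Fin.exists_succ_eq.2 fun h0 => hM ?_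
    simpa using congrArg Fin.val h0
  have := congrFun h.last_correction m
  simp only [opL1, opL2Relaxed, Pi.sub_apply, substepTime_zero_right hβ0,
    h.start (K + 2) le_rfl,
    show K + 2 - 1 = K + 1 from rfl, h.start (K + 1) (by omega), hm, if_true] at this
  rw [sub_sub, sub_eq_iff_eq_add] at this
  rw [this]
  simp only [substepTime, Nat.add_eq_zero_iff, one_ne_zero, and_false, if_false]
  abel

lemma sum_butcherB_smul {F : Type*} [AddCommGroup F] [Module ℝ F] (β : Fin (M + 1) → ℝ)
    (φ : Stage (K + 2) M → F) :
    ∑ i, butcherB (K + 2) β i • φ i = theta β 0 (Fin.last M) • φ none +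
      ∑ r : Fin M, theta β r.succ (Fin.last M) • φ (some ((⟨K, by omega⟩ : Fin (K + 2 - 1)), r)) := by
  rw [Fintype.sum_option, Fintype.sum_prod_type]
  congr 1
  rw [Finset.sum_eq_single (⟨K, by omega⟩ : Fin (K + 2 - 1))]
  · simp [butcherB]
  · intro k _ hk
    have : (k : ℕ) ≠ K := fun h => hk (Fin.ext h)
    simp [butcherB, this]
  · simp

/-- The stages of DeC satisfy the equations of the Butcher tableau. -/
theorem IsRDeCStep.smul_sum_butcherA (h : IsRDeCStep (K + 2) β f t Δt y Y γ)
    (hβ : Function.Injective β) (hβ0 : β 0 = 0) (i : Stage (K + 2) M) :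
    Δt • ∑ j, butcherA (K + 2) β i j •
      f (t + butcherC (K + 2) β j * Δt) (stageValue (K + 2) y Y j) =
      stageValue (K + 2) y Y i - y := by
  rcases i with _ | ⟨k, m⟩
  · simp [butcherA, stageValue]
  have hk : (k : ℕ) + 1 < K + 2 := by have := k.2; omega
  have e := h.iterate_succ hβ0 hk m.succ
  change _ = Y (k + 1) m.succ - y
  rw [e, add_sub_cancel_left]
  congr 1
  rw [Fintype.sum_option, Fintype.sum_prod_type]
  -- In the first block all stage derivatives of the initial guess equal `f t y`, since its time is
  -- frozen at `t`; the weights add up to the single entry `β m.succ`.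
  rcases Nat.eq_zero_or_pos (k : ℕ) with hk0 | hk0
  · simp [butcherA, hk0, substepTime, h.init, butcherC, stageValue, ← Finset.sum_smul,
      sum_theta hβ]
  · obtain ⟨l, hl⟩ : ∃ l, (k : ℕ) = l + 1 := ⟨k - 1, by omega⟩
    have hlK : l < K + 2 - 1 := by have := k.2; omega
    rw [Finset.sum_eq_single (⟨l, hlK⟩ : Fin (K + 2 - 1))]
    · simp [butcherA, hl, substepTime, butcherC, stageValue, Fin.sum_univ_succ, hβ0,
        h.start (l + 1) (by omega)]
    · intro k' _ hk'
      have : (k' : ℕ) + 1 ≠ k := fun h => hk' (Fin.ext (by simp; omega))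
      simp [butcherA, this]
    · simp

/-- The relaxation coefficient in terms of the last stages. -/
theorem IsRDeCStep.gamma_spec (h : IsRDeCStep (K + 2) β f t Δt y Y γ)
    (hβ : Function.Injective β) (hβ0 : β 0 = 0) :
    let S := ∑ r, theta β r (Fin.last M) • f (t + β r * Δt) (Y (K + 1) r)
    (S = 0 → γ = 1) ∧ (S ≠ 0 → γ * ‖S‖ ^ 2 * Δt = 2 * ∑ r, theta β r (Fin.last M) *
      inner ℝ (f (t + β r * Δt) (Y (K + 1) r)) (Y (K + 1) r - y)) := by
  intro S
  set F : Stage (K + 2) M → E :=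
    fun i => f (t + butcherC (K + 2) β i * Δt) (stageValue (K + 2) y Y i) with hF
  have hS : ∑ i, butcherB (K + 2) β i • F i = S := by
    rw [sum_butcherB_smul]
    simp [S, F, Fin.sum_univ_succ, butcherC, stageValue, hβ0, h.start (K + 1) (by omega)]
  have hγ := h.gamma_eq
  rw [gammaDeC, ← hF, relaxationCoeff, hS] at hγ
  constructor
  · intro h0
    simpa [h0] using hγ
  · intro h0
    have hden : ∑ i, ∑ j, butcherB (K + 2) β i * butcherB (K + 2) β j * inner ℝ (F i) (F j) =
        ‖S‖ ^ 2 := by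
      rw [← hS, ← real_inner_self_eq_norm_sq, sum_inner]
      refine Finset.sum_congr rfl fun i _ => ?_
      rw [inner_sum]
      refine Finset.sum_congr rfl fun j _ => ?_
      rw [real_inner_smul_left, real_inner_smul_right]
      ring
    -- The factor `Δt` lets the stage equations replace the inner sum over `j` by the stage
    -- displacement.
    have hnum : Δt * ∑ i, ∑ j, butcherB (K + 2) β i * butcherA (K + 2) β i j *
        inner ℝ (F i) (F j) = ∑ r, theta β r (Fin.last M) *
          inner ℝ (f (t + β r * Δt) (Y (K + 1) r)) (Y (K + 1) r - y) := by
      have : ∀ i, Δt * ∑ j, butcherB (K + 2) β i * butcherA (K + 2) β i j * inner ℝ (F i) (F j) =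
          butcherB (K + 2) β i • inner ℝ (F i) (stageValue (K + 2) y Y i - y) := by
        intro i
        rw [← h.smul_sum_butcherA hβ hβ0 i, real_inner_smul_right, inner_sum, smul_eq_mul,
          Finset.mul_sum, Finset.mul_sum, Finset.mul_sum]
        refine Finset.sum_congr rfl fun j _ => ?_
        rw [real_inner_smul_right]
        ring
      rw [Finset.mul_sum, Finset.sum_congr rfl fun i _ => this i, sum_butcherB_smul]
      simp [F, Fin.sum_univ_succ, butcherC, stageValue, hβ0, h.start (K + 1) (by omega)]
    have hS2 : ‖S‖ ^ 2 ≠ 0 := by simpa using h0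
    rw [if_pos hS2, hden, eq_div_iff hS2] at hγ
    rw [hγ, ← hnum]
    ring

end Step

/-! ### Local error of stages, relaxation coefficient and relaxed update. -/

section LocalError

variable {E : Type*} [NormedAddCommGroup E] [InnerProductSpace ℝ E] {N : ℕ}

/-- An RDeC step with `N + 2` corrections next to the exact solution `u` with the same start, in a
region `D`. The step size is small compared to the bound `B` of `f` and the bound `Θ` of the
quadrature weights. -/
structure IsStepNear (β : Fin (N + 2) → ℝ) (f : ℝ → E → E) (D : Set (ℝ × E)) (Θ B : ℝ)
    (t Δt : ℝ) (y : E) (Y : ℕ → Fin (N + 2) → E) (γ : ℝ) (u : ℝ → E) : Prop where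
  step : IsRDeCStep (N + 2) β f t Δt y Y γ
  pos : 0 < Δt
  le_one : Δt ≤ 1
  small : Δt * (Θ * B) ≤ 1
  subset : Icc t (t + 2 * Δt) ×ˢ closedBall y 1 ⊆ D
  start : u t = y
  sol : SolvesIn f D t (t + 2 * Δt) u

/-- The nodes are admissible and `Θ` bounds the quadrature weights. -/
structure IsNodes (β : Fin (N + 2) → ℝ) (Θ : ℝ) : Prop where
  mono : StrictMono β
  zero : β 0 = 0
  one : β (Fin.last (N + 1)) = 1
  weights : ∀ m, ∑ r, |theta β r m| ≤ Θ

/-- `f` is bounded by `B` and Lipschitz continuous in the region `D`. -/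
structure IsRegion (f : ℝ → E → E) (D : Set (ℝ × E)) (B : ℝ) (L : NNReal) : Prop where
  bound : ∀ p ∈ D, ‖f p.1 p.2‖ ≤ B
  lipschitz : LipschitzOnWith L (fun p : ℝ × E => f p.1 p.2) D

variable {β : Fin (N + 2) → ℝ} {f : ℝ → E → E} {D : Set (ℝ × E)} {Θ B : ℝ} {L : NNReal}
  {t Δt : ℝ} {y : E} {Y : ℕ → Fin (N + 2) → E} {γ : ℝ} {u : ℝ → E}

lemma IsNodes.nonneg (hβ : IsNodes β Θ) : 0 ≤ Θ :=
  (Finset.sum_nonneg fun _ _ => abs_nonneg _).trans (hβ.weights 0)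

lemma IsNodes.norm_sum_le {F : Type*} [NormedAddCommGroup F] [NormedSpace ℝ F] (hβ : IsNodes β Θ)
    (m : Fin (N + 2)) {g : Fin (N + 2) → F} {b : ℝ} (hb : 0 ≤ b) (hg : ∀ r, ‖g r‖ ≤ b) :
    ‖∑ r, theta β r m • g r‖ ≤ Θ * b := by
  refine (norm_sum_le_of_le _ (f := fun r => theta β r m • g r)
    (n := fun r => |theta β r m| * b) fun r _ => ?_).trans ?_
  · rw [norm_smul, Real.norm_eq_abs]
    gcongr
    exact hg r
  · rw [← Finset.sum_mul]
    gcongr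
    exact hβ.weights m

lemma IsNodes.substepTime_mem (hβ : IsNodes β Θ) (hΔ : 0 ≤ Δt) (k : ℕ) (r : Fin (N + 2)) :
    substepTime β t Δt k r ∈ Icc t (t + Δt) := by
  rw [substepTime]
  split_ifs
  · exact ⟨le_rfl, by linarith⟩
  · exact add_node_mul_mem_Icc hβ.mono hβ.zero hβ.one r hΔ

namespace IsStepNear

lemma start_mem (h : IsStepNear β f D Θ B t Δt y Y γ u) : (t, y) ∈ D :=
  h.subset ⟨⟨le_rfl, by linarith [h.pos]⟩, mem_closedBall_self zero_le_one⟩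

lemma bound_nonneg (h : IsStepNear β f D Θ B t Δt y Y γ u) (hD : IsRegion f D B L) : 0 ≤ B :=
  (norm_nonneg _).trans (hD.bound _ h.start_mem)

/-- The stages stay close to the start value. -/
lemma norm_iterate_sub_le (h : IsStepNear β f D Θ B t Δt y Y γ u) (hβ : IsNodes β Θ)
    (hD : IsRegion f D B L) {k : ℕ} (hk : k ≤ N + 1) (m : Fin (N + 2)) :
    ‖Y k m - y‖ ≤ Δt * (Θ * B) := by
  have hB := h.bound_nonneg hD
  have hΘ := hβ.nonneg
  have hΔ := h.pos
  induction k generalizing m with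
  | zero =>
    rw [h.step.init, sub_self, norm_zero]
    positivity
  | succ k ih =>
    rw [h.step.iterate_succ hβ.zero (by omega), add_sub_cancel_left, norm_smul,
      Real.norm_of_nonneg hΔ.le]
    gcongr
    refine hβ.norm_sum_le m hB fun r => hD.bound (substepTime β t Δt k r, Y k r) (h.subset ⟨?_, ?_⟩)
    · exact Icc_subset_Icc_right (by linarith) (hβ.substepTime_mem hΔ.le k r)
    · exact mem_closedBall_iff_norm.2 ((ih (by omega) r).trans h.small)

lemma stage_mem (h : IsStepNear β f D Θ B t Δt y Y γ u) (hβ : IsNodes β Θ)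
    (hD : IsRegion f D B L) {k : ℕ} (hk : k ≤ N + 1) (m : Fin (N + 2)) :
    (substepTime β t Δt k m, Y k m) ∈ D :=
  h.subset ⟨Icc_subset_Icc_right (by linarith [h.pos]) (hβ.substepTime_mem h.pos.le k m),
    mem_closedBall_iff_norm.2 ((h.norm_iterate_sub_le hβ hD hk m).trans h.small)⟩

lemma sol_mem (h : IsStepNear β f D Θ B t Δt y Y γ u) (hβ : IsNodes β Θ) (m : Fin (N + 2)) :
    (t + β m * Δt, u (t + β m * Δt)) ∈ D :=
  h.sol.mem _ (Icc_subset_Icc_right (by linarith [h.pos])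
    (add_node_mul_mem_Icc hβ.mono hβ.zero hβ.one m h.pos.le))

lemma norm_sol_sub_le (h : IsStepNear β f D Θ B t Δt y Y γ u) (hD : IsRegion f D B L)
    {s : ℝ} (hs : s ∈ Icc t (t + 2 * Δt)) : ‖u s - y‖ ≤ B * (s - t) := by
  have := norm_image_sub_le_of_norm_deriv_le_segment' (C := B) h.sol.deriv
    (fun x hx => hD.bound _ (h.sol.mem x (Ico_subset_Icc_self hx))) s hs
  rwa [h.start] at this

end IsStepNear

/-- The quadrature of `G` along the stages `k`, compared with the integral of `G` along the exact
solution. -/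
theorem exists_stage_quadrature_bound {F : Type*} [NormedAddCommGroup F] [NormedSpace ℝ F]
    (hβ : IsNodes β Θ) (hD : IsRegion f D B L) (hDc : IsCompact D) (hDconv : Convex ℝ D)
    (hf : ContDiff ℝ (N + 2 : ℕ) (fun p : ℝ × E => f p.1 p.2)) {G : ℝ × E → F}
    (hG : ContDiff ℝ (N + 2 : ℕ) G) {k : ℕ} (hk : k ≤ N + 1) {C : ℝ} (hC : 0 ≤ C) :
    ∃ C' ≥ 0, ∀ t Δt y Y γ u, IsStepNear β f D Θ B t Δt y Y γ u →
      (∀ r, ‖Y k r - u (t + β r * Δt)‖ ≤ C * Δt ^ (k + 1)) →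
      ∀ Q : ℝ → F, (∀ s ∈ Icc t (t + Δt),
        HasDerivWithinAt Q (G (s, u s)) (Icc t (t + Δt)) s) → ∀ m,
      ‖Q (t + β m * Δt) - Q t -
        Δt • ∑ r, theta β r m • G (substepTime β t Δt k r, Y k r)‖ ≤ C' * Δt ^ (k + 2) := by
  obtain ⟨C₁, hC₁, hexp⟩ := exists_expansion hDc (N + 2) hf G hG
  obtain ⟨L', hL'⟩ := hG.contDiffOn.exists_lipschitzOnWith (s := D) (by norm_cast) hDconv hDc
  have hΘ := hβ.nonneg
  refine ⟨(1 + Θ) * C₁ + Θ * (L' * (1 + C)), by positivity,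
    fun t Δt y Y γ u h hY Q hQ m => ?_⟩
  have hΔ := h.pos
  have hsub : Icc t (t + Δt) ⊆ Icc t (t + 2 * Δt) := Icc_subset_Icc_right (by linarith)
  obtain ⟨c, hc⟩ := hexp _ _ _ h.sol
  have h1 := norm_quadrature_error_le hβ.mono hβ.zero hβ.one m hΔ.le hC₁ hQ
    (fun s hs => hc s (hsub hs))
  have hdist : ∀ r, dist (t + β r * Δt, u (t + β r * Δt)) (substepTime β t Δt k r, Y k r) ≤
      (1 + C) * Δt ^ (k + 1) := by
    intro r
    have hr := node_mem_Icc hβ.mono hβ.zero hβ.one r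
    have hp : 0 ≤ Δt ^ (k + 1) := by positivity
    rw [Prod.dist_eq]
    refine max_le ?_ ?_
    -- Freezing the time for `k = 0` shifts it by at most `Δt`, the same order as the error of the
    -- initial guess.
    · rw [substepTime]
      split_ifs with hk0
      · subst hk0
        rw [Real.dist_eq, add_sub_cancel_left, abs_of_nonneg (mul_nonneg hr.1 hΔ.le)]
        have : β r * Δt ≤ 1 * Δt := by gcongr; exact hr.2
        simp only [zero_add, pow_one]
        nlinarith
      · rw [dist_self]
        positivity
    · rw [dist_comm, dist_eq_norm]
      linarith [hY r]
  have h2 : ‖∑ r, theta β r m • (G (t + β r * Δt, u (t + β r * Δt)) -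
      G (substepTime β t Δt k r, Y k r))‖ ≤ Θ * (L' * ((1 + C) * Δt ^ (k + 1))) := by
    refine hβ.norm_sum_le m (by positivity) fun r => ?_
    rw [← dist_eq_norm]
    refine (hL'.dist_le_mul _ (h.sol_mem hβ r) _ (h.stage_mem hβ hD hk r)).trans ?_
    gcongr
    exact hdist r
  -- The quadrature error is never the dominant term, since `k ≤ N + 1`.
  have hpow : Δt ^ (N + 3) ≤ Δt ^ (k + 2) := pow_le_pow_of_le_one hΔ.le h.le_one (by omega)
  calc ‖Q (t + β m * Δt) - Q t - Δt • ∑ r, theta β r m • G (substepTime β t Δt k r, Y k r)‖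
      = ‖(Q (t + β m * Δt) - Q t -
          Δt • ∑ r, theta β r m • G (t + β r * Δt, u (t + β r * Δt))) +
          Δt • ∑ r, theta β r m • (G (t + β r * Δt, u (t + β r * Δt)) -
            G (substepTime β t Δt k r, Y k r))‖ := by
        simp only [smul_sub, Finset.sum_sub_distrib]
        congr 1
        abel
    _ ≤ (1 + Θ) * C₁ * Δt ^ (k + 2) + Δt * (Θ * (L' * ((1 + C) * Δt ^ (k + 1)))) := by
        refine norm_add_le_of_le (h1.trans ?_) ?_
        · gcongr
          exact hβ.weights m
        · rw [norm_smul, Real.norm_of_nonneg hΔ.le]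
          gcongr
    _ = ((1 + Θ) * C₁ + Θ * (L' * (1 + C))) * Δt ^ (k + 2) := by ring

/-- The `k`-th iterates are accurate of order `k + 1`. -/
theorem exists_stage_error_bound (hβ : IsNodes β Θ) (hD : IsRegion f D B L) (hDc : IsCompact D)
    (hDconv : Convex ℝ D) (hB : 0 ≤ B)
    (hf : ContDiff ℝ (N + 2 : ℕ) (fun p : ℝ × E => f p.1 p.2))
    {k : ℕ} (hk : k ≤ N + 1) :
    ∃ C ≥ 0, ∀ t Δt y Y γ u, IsStepNear β f D Θ B t Δt y Y γ u → ∀ r,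
      ‖Y k r - u (t + β r * Δt)‖ ≤ C * Δt ^ (k + 1) := by
  induction k with
  | zero =>
    refine ⟨B, hB, fun t Δt y Y γ u h r => ?_⟩
    have hr := add_node_mul_mem_Icc hβ.mono hβ.zero hβ.one r (t := t) h.pos.le
    rw [h.step.init, norm_sub_rev, zero_add, pow_one]
    refine (h.norm_sol_sub_le hD (Icc_subset_Icc_right (by linarith [h.pos]) hr)).trans ?_
    gcongr
    linarith [hr.2]
  | succ k ih =>
    obtain ⟨C, hC, hY⟩ := ih (by omega)
    obtain ⟨C', hC', hQ⟩ := exists_stage_quadrature_bound hβ hD hDc hDconv hf hf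
      (k := k) (by omega) hC
    refine ⟨C', hC', fun t Δt y Y γ u h r => ?_⟩
    have hsub : Icc t (t + Δt) ⊆ Icc t (t + 2 * Δt) := Icc_subset_Icc_right (by linarith [h.pos])
    have := hQ t Δt y Y γ u h (hY t Δt y Y γ u h) u
      (fun s hs => (h.sol.deriv s (hsub hs)).mono hsub) r
    rw [h.step.iterate_succ hβ.zero (by omega), norm_sub_rev, ← sub_sub, ← h.start]
    exact this

/-- The quadrature of `f` in the last correction. -/
def lastIncrement (β : Fin (N + 2) → ℝ) (f : ℝ → E → E) (t Δt : ℝ) (Y : ℕ → Fin (N + 2) → E) : E :=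
  ∑ r, theta β r (Fin.last (N + 1)) • f (t + β r * Δt) (Y (N + 1) r)

/-- Without relaxation, the step is accurate of order `N + 3`. -/
theorem exists_unrelaxed_error_bound (hβ : IsNodes β Θ) (hD : IsRegion f D B L)
    (hDc : IsCompact D) (hDconv : Convex ℝ D) (hB : 0 ≤ B)
    (hf : ContDiff ℝ (N + 2 : ℕ) (fun p : ℝ × E => f p.1 p.2)) :
    ∃ C ≥ 0, ∀ t Δt y Y γ u, IsStepNear β f D Θ B t Δt y Y γ u →
      ‖u (t + Δt) - y - Δt • lastIncrement β f t Δt Y‖ ≤ C * Δt ^ (N + 3) := by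
  obtain ⟨C, hC, hY⟩ := exists_stage_error_bound hβ hD hDc hDconv hB hf (k := N + 1) le_rfl
  obtain ⟨C', hC', hQ⟩ := exists_stage_quadrature_bound hβ hD hDc hDconv hf hf
    (k := N + 1) le_rfl hC
  refine ⟨C', hC', fun t Δt y Y γ u h => ?_⟩
  have hsub : Icc t (t + Δt) ⊆ Icc t (t + 2 * Δt) := Icc_subset_Icc_right (by linarith [h.pos])
  have := hQ t Δt y Y γ u h (hY t Δt y Y γ u h) u
    (fun s hs => (h.sol.deriv s (hsub hs)).mono hsub) (Fin.last _)
  simpa [hβ.one, h.start, substepTime, lastIncrement] using this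

/-- The relaxation coefficient is `1` up to an error of order `N + 1`. -/
theorem exists_gamma_bound (hβ : IsNodes β Θ) (hD : IsRegion f D B L)
    (hDc : IsCompact D) (hDconv : Convex ℝ D) (hB : 0 ≤ B)
    (hf : ContDiff ℝ (N + 2 : ℕ) (fun p : ℝ × E => f p.1 p.2)) {c : ℝ} (hc : 0 < c) :
    ∃ C ≥ 0, ∀ t Δt y Y γ u, IsStepNear β f D Θ B t Δt y Y γ u →
      c ≤ ‖lastIncrement β f t Δt Y‖ → |γ - 1| ≤ C * Δt ^ (N + 1) := by
  obtain ⟨C, hC, hY⟩ := exists_stage_error_bound hβ hD hDc hDconv hB hf (k := N + 1) le_rfl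
  obtain ⟨C₁, hC₁, hZ⟩ := exists_unrelaxed_error_bound hβ hD hDc hDconv hB hf
  -- This integrand is the derivative of `‖u‖ ^ 2` along solutions.
  obtain ⟨C₂, hC₂, hQ⟩ := exists_stage_quadrature_bound hβ hD hDc hDconv hf
    (G := fun p : ℝ × E => 2 * inner ℝ p.2 (f p.1 p.2))
    (contDiff_const.mul (contDiff_snd.inner ℝ hf)) (k := N + 1) le_rfl hC
  obtain ⟨ρ, hρ⟩ := hDc.exists_bound_of_continuousOn (f := fun p : ℝ × E => p.2)
    continuous_snd.continuousOn
  refine ⟨(C₂ + 2 * |ρ| * C₁) / c ^ 2, by positivity, fun t Δt y Y γ u h hS => ?_⟩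
  have hΔ := h.pos
  have hsub : Icc t (t + Δt) ⊆ Icc t (t + 2 * Δt) := Icc_subset_Icc_right (by linarith)
  set S := lastIncrement β f t Δt Y with hSdef
  have hS0 : S ≠ 0 := norm_pos_iff.1 (hc.trans_le hS)
  set q := ∑ r, theta β r (Fin.last (N + 1)) *
    (2 * inner ℝ (Y (N + 1) r) (f (t + β r * Δt) (Y (N + 1) r))) with hq
  have hquad : |‖u (t + Δt)‖ ^ 2 - ‖y‖ ^ 2 - Δt * q| ≤ C₂ * Δt ^ (N + 3) := by
    have := hQ t Δt y Y γ u h (hY t Δt y Y γ u h) (fun s => ‖u s‖ ^ 2)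
      (fun s hs => ((h.sol.deriv s (hsub hs)).mono hsub).norm_sq) (Fin.last _)
    simpa [hβ.one, h.start, substepTime, hq] using this
  have hγ : γ * ‖S‖ ^ 2 * Δt = q - 2 * inner ℝ S y := by
    rw [show γ * ‖S‖ ^ 2 * Δt = _ from (h.step.gamma_spec hβ.mono.injective hβ.zero).2 hS0, hSdef,
      lastIncrement, sum_inner, hq,
      Finset.mul_sum, Finset.mul_sum, ← Finset.sum_sub_distrib]
    refine Finset.sum_congr rfl fun r _ => ?_
    rw [inner_sub_right, real_inner_smul_left, real_inner_comm (Y (N + 1) r)]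
    ring
  have hZsq : ‖y + Δt • S‖ ^ 2 = ‖y‖ ^ 2 + 2 * (Δt * inner ℝ S y) + Δt ^ 2 * ‖S‖ ^ 2 := by
    rw [norm_add_sq_real, real_inner_smul_right, real_inner_comm, norm_smul,
      Real.norm_of_nonneg hΔ.le]
    ring
  have hSB : ‖S‖ ≤ Θ * B := hβ.norm_sum_le _ hB fun r => by
    simpa [substepTime] using hD.bound _ (h.stage_mem hβ hD (k := N + 1) le_rfl r)
  have hZmem : ‖y + Δt • S‖ ≤ |ρ| := by
    refine (hρ (t, y + Δt • S) (h.subset ⟨⟨le_rfl, by linarith⟩, ?_⟩)).trans (le_abs_self _)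
    rw [mem_closedBall_iff_norm, add_sub_cancel_left, norm_smul, Real.norm_of_nonneg hΔ.le]
    exact le_trans (by gcongr) h.small
  have humem : ‖u (t + Δt)‖ ≤ |ρ| :=
    (hρ (t + Δt, u (t + Δt)) (h.sol.mem _ ⟨by linarith, by linarith⟩)).trans (le_abs_self _)
  have hsq : |‖u (t + Δt)‖ ^ 2 - ‖y + Δt • S‖ ^ 2| ≤ 2 * |ρ| * C₁ * Δt ^ (N + 3) := by
    have h1 : |‖u (t + Δt)‖ - ‖y + Δt • S‖| ≤ C₁ * Δt ^ (N + 3) := by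
      refine (abs_norm_sub_norm_le _ _).trans ?_
      rw [← sub_sub]
      exact hZ t Δt y Y γ u h
    calc |‖u (t + Δt)‖ ^ 2 - ‖y + Δt • S‖ ^ 2|
        = (‖u (t + Δt)‖ + ‖y + Δt • S‖) * |‖u (t + Δt)‖ - ‖y + Δt • S‖| := by
          rw [sq_sub_sq, abs_mul, abs_of_nonneg (by positivity)]
      _ ≤ (|ρ| + |ρ|) * (C₁ * Δt ^ (N + 3)) := by gcongr
      _ = _ := by ring
  -- Energy balance: `hγ` gives `‖y + Δt • S‖ ^ 2 + (γ - 1) * ‖S‖ ^ 2 * Δt ^ 2 = ‖y‖ ^ 2 + Δt * q`.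
  have key : (γ - 1) * ‖S‖ ^ 2 * Δt ^ 2 = (‖u (t + Δt)‖ ^ 2 - ‖y + Δt • S‖ ^ 2) -
      (‖u (t + Δt)‖ ^ 2 - ‖y‖ ^ 2 - Δt * q) := by
    rw [hZsq]
    linear_combination Δt * hγ
  have habs : |γ - 1| * ‖S‖ ^ 2 * Δt ^ 2 ≤ (C₂ + 2 * |ρ| * C₁) * Δt ^ (N + 3) := by
    calc |γ - 1| * ‖S‖ ^ 2 * Δt ^ 2 = |(γ - 1) * ‖S‖ ^ 2 * Δt ^ 2| := by
          rw [abs_mul, abs_mul, abs_of_nonneg (sq_nonneg ‖S‖), abs_of_nonneg (sq_nonneg Δt)]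
      _ ≤ _ := by
          rw [key]
          refine (abs_sub _ _).trans ?_
          linarith
  have hle : |γ - 1| * c ^ 2 ≤ |γ - 1| * ‖S‖ ^ 2 := by gcongr
  rw [div_mul_eq_mul_div, le_div_iff₀ (by positivity)]
  refine hle.trans (le_of_mul_le_mul_right (habs.trans_eq ?_) (by positivity : 0 < Δt ^ 2))
  ring

/-- The last increment is close to the derivative at the start of the step. -/
lemma norm_lastIncrement_sub_le (hβ : IsNodes β Θ) (hD : IsRegion f D B L)
    (h : IsStepNear β f D Θ B t Δt y Y γ u) :
    ‖lastIncrement β f t Δt Y - f t y‖ ≤ Θ * (L * (1 + Θ * B)) * Δt := by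
  have hΔ := h.pos
  have hΘ := hβ.nonneg
  have hB := h.bound_nonneg hD
  have h1 : lastIncrement β f t Δt Y - f t y =
      ∑ r, theta β r (Fin.last (N + 1)) • (f (t + β r * Δt) (Y (N + 1) r) - f t y) := by
    simp only [smul_sub, Finset.sum_sub_distrib, ← Finset.sum_smul,
      sum_theta hβ.mono.injective, hβ.one, one_smul, lastIncrement]
  rw [h1]
  refine (hβ.norm_sum_le _ (b := L * ((1 + Θ * B) * Δt)) (by positivity) fun r => ?_).trans_eq
    (by ring)
  have hm := h.stage_mem hβ hD (k := N + 1) le_rfl r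
  simp only [substepTime, Nat.add_eq_zero_iff, one_ne_zero, and_false, if_false] at hm
  rw [← dist_eq_norm]
  refine (hD.lipschitz.dist_le_mul _ hm _ h.start_mem).trans ?_
  gcongr
  have hr := add_node_mul_mem_Icc hβ.mono hβ.zero hβ.one r (t := t) hΔ.le
  have hp : 0 ≤ Θ * B := by positivity
  rw [Prod.dist_eq]
  refine max_le ?_ ?_
  · rw [Real.dist_eq, abs_of_nonneg (by linarith [hr.1])]
    nlinarith [hr.2]
  · rw [dist_eq_norm]
    have := h.norm_iterate_sub_le hβ hD (k := N + 1) le_rfl r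
    simp only
    linarith

/-- The solution is affine up to an error of second order. -/
lemma norm_sol_relaxed_sub_le (hD : IsRegion f D B L) (h : IsStepNear β f D Θ B t Δt y Y γ u)
    (hγ : |γ - 1| ≤ 1) :
    ‖y + γ • (u (t + Δt) - y) - u (t + γ * Δt)‖ ≤ 4 * L * (1 + B) * |γ - 1| * Δt ^ 2 := by
  have hΔ := h.pos
  have hB := h.bound_nonneg hD
  obtain ⟨hγ0, hγ2⟩ := abs_le.1 hγ
  -- The defect to be bounded is linear in `u` and zero for affine functions, so the tangent at `t`
  -- may be subtracted; the Lipschitz constant of `w` is then of order `Δt`.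
  set w : ℝ → E := fun s => u s - (s - t) • f t y with hw
  have hwd : ∀ s ∈ Icc t (t + 2 * Δt),
      HasDerivWithinAt w (f s (u s) - f t y) (Icc t (t + 2 * Δt)) s := by
    intro s hs
    refine ((h.sol.deriv s hs).sub
      (((hasDerivWithinAt_id s _).sub_const t).smul_const (f t y))).congr_deriv ?_
    simp
  have hwb : ∀ s ∈ Icc t (t + 2 * Δt), ‖f s (u s) - f t y‖ ≤ L * ((1 + B) * (2 * Δt)) := by
    intro s hs
    rw [← dist_eq_norm]
    refine (hD.lipschitz.dist_le_mul _ (h.sol.mem s hs) _ h.start_mem).trans ?_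
    gcongr
    rw [Prod.dist_eq]
    refine max_le ?_ ?_
    · rw [Real.dist_eq, abs_of_nonneg (by linarith [hs.1])]
      nlinarith [hs.2]
    · rw [dist_eq_norm]
      refine (h.norm_sol_sub_le hD hs).trans ?_
      have : s - t ≤ 2 * Δt := by linarith [hs.2]
      have : B * (s - t) ≤ B * (2 * Δt) := by gcongr
      nlinarith
  have hmv : ∀ a ∈ Icc t (t + 2 * Δt), ∀ b ∈ Icc t (t + 2 * Δt),
      ‖w b - w a‖ ≤ L * ((1 + B) * (2 * Δt)) * ‖b - a‖ := fun a ha b hb =>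
    (convex_Icc t (t + 2 * Δt)).norm_image_sub_le_of_norm_hasDerivWithin_le hwd hwb ha hb
  have m0 : t ∈ Icc t (t + 2 * Δt) := ⟨le_rfl, by linarith⟩
  have m1 : t + Δt ∈ Icc t (t + 2 * Δt) := ⟨by linarith, by linarith⟩
  have mγ : t + γ * Δt ∈ Icc t (t + 2 * Δt) := ⟨by nlinarith, by nlinarith⟩
  have e : y + γ • (u (t + Δt) - y) - u (t + γ * Δt) =
      (γ - 1) • (w (t + Δt) - w t) + (w (t + Δt) - w (t + γ * Δt)) := by
    simp only [hw, h.start, add_sub_cancel_left, sub_self, zero_smul, sub_zero]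
    module
  rw [e]
  refine (norm_add_le_of_le ((norm_smul_le _ _).trans
    (mul_le_mul_of_nonneg_left (hmv _ m0 _ m1) (norm_nonneg _))) (hmv _ mγ _ m1)).trans_eq ?_
  rw [show t + Δt - (t + γ * Δt) = -((γ - 1) * Δt) by ring, norm_neg, norm_mul,
    add_sub_cancel_left, Real.norm_of_nonneg hΔ.le, Real.norm_eq_abs]
  ring

/-- Local error of the relaxed step, provided that the relaxation coefficient is close to `1`. -/
theorem exists_relaxed_error_bound (hβ : IsNodes β Θ) (hD : IsRegion f D B L)
    (hDc : IsCompact D) (hDconv : Convex ℝ D) (hB : 0 ≤ B)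
    (hf : ContDiff ℝ (N + 2 : ℕ) (fun p : ℝ × E => f p.1 p.2)) {Cγ : ℝ} (hCγ : 0 ≤ Cγ) :
    ∃ C ≥ 0, ∀ t Δt y Y γ u, IsStepNear β f D Θ B t Δt y Y γ u →
      |γ - 1| ≤ 1 → |γ - 1| ≤ Cγ * Δt ^ (N + 1) →
      ‖Y (N + 2) (Fin.last (N + 1)) - u (t + γ * Δt)‖ ≤ C * Δt ^ (N + 3) := by
  obtain ⟨C₁, hC₁, hZ⟩ := exists_unrelaxed_error_bound hβ hD hDc hDconv hB hf
  refine ⟨2 * C₁ + 4 * L * (1 + B) * Cγ, by positivity, fun t Δt y Y γ u h hγ1 hγ => ?_⟩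
  have hΔ := h.pos
  obtain ⟨hγ0, hγ2⟩ := abs_le.1 hγ1
  have hfin := h.step.final_eq hβ.zero (Nat.succ_ne_zero N)
  change _ = y + (γ * Δt) • lastIncrement β f t Δt Y at hfin
  have e : Y (N + 2) (Fin.last (N + 1)) - u (t + γ * Δt) =
      -(γ • (u (t + Δt) - y - Δt • lastIncrement β f t Δt Y)) +
        (y + γ • (u (t + Δt) - y) - u (t + γ * Δt)) := by
    rw [hfin]
    module
  rw [e]
  calc _ ≤ 2 * (C₁ * Δt ^ (N + 3)) + 4 * L * (1 + B) * (Cγ * Δt ^ (N + 1)) * Δt ^ 2 := by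
        refine norm_add_le_of_le ?_ ((norm_sol_relaxed_sub_le hD h hγ1).trans (by gcongr))
        rw [norm_neg, norm_smul, Real.norm_eq_abs]
        gcongr
        · rw [abs_le]; constructor <;> linarith
        · exact hZ t Δt y Y γ u h
    _ = (2 * C₁ + 4 * L * (1 + B) * Cγ) * Δt ^ (N + 3) := by ring

/-- Local error of the RDeC method: where `f` is bounded away from zero, the relaxation
coefficient and the new value are accurate of the order `N + 1` and `N + 3` in the step size. -/
theorem exists_local_error_bound [CompleteSpace E] (hβ : IsNodes β Θ) (hD : IsRegion f D B L)
    (hDc : IsCompact D) (hDconv : Convex ℝ D) (hB : 0 ≤ B)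
    (hf : ContDiff ℝ (N + 2 : ℕ) (fun p : ℝ × E => f p.1 p.2)) {c : ℝ} (hc : 0 < c) :
    ∃ C > 0, ∃ h₀ > 0, ∀ t y, Icc t (t + 1) ×ˢ closedBall y 1 ⊆ D → c ≤ ‖f t y‖ →
      ∀ Δt, 0 < Δt → Δt ≤ h₀ → ∀ Y γ, IsRDeCStep (N + 2) β f t Δt y Y γ →
        |γ - 1| ≤ C * Δt ^ (N + 1) ∧ |γ - 1| ≤ 1 / 2 ∧
        ∃ u, u t = y ∧ SolvesIn f D t (t + 2 * Δt) u ∧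
          ‖Y (N + 2) (Fin.last (N + 1)) - u (t + γ * Δt)‖ ≤ C * Δt ^ (N + 3) := by
  obtain ⟨C₁, hC₁, hγ⟩ := exists_gamma_bound hβ hD hDc hDconv hB hf (half_pos hc)
  -- The constant for `γ` was taken with `c / 2`: half of the lower bound for `f t y` is given up to
  -- pass to the last increment.
  obtain ⟨C₂, hC₂, hY⟩ := exists_relaxed_error_bound hβ hD hDc hDconv hB hf hC₁
  have hΘ := hβ.nonneg
  set κ := Θ * (L * (1 + Θ * B)) with hκ
  have hκ0 : 0 ≤ κ := by positivity
  -- With `Δt * H ≤ 1` the summands give, in order: `2 * Δt ≤ 1`, the solution stays in the unit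
  -- ball up to `t + 2 * Δt`, so do the stages, the last increment has norm at least `c / 2`, and
  -- `|γ - 1| ≤ 1 / 2`.
  set H := 2 + 2 * B + Θ * B + 2 * κ / c + 2 * C₁ with hH
  have hκc : 0 ≤ 2 * κ / c := by positivity
  have hΘB : 0 ≤ Θ * B := by positivity
  have hH0 : 0 < H := by positivity
  refine ⟨C₁ + C₂ + 1, by positivity, H⁻¹, by positivity,
    fun t y hsub hfc Δt hΔ hΔH Y γ hstep => ?_⟩
  have hHΔ : Δt * H ≤ 1 := by
    rwa [← le_div_iff₀ hH0, one_div]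
  have hexp : Δt * 2 + Δt * (2 * B) + Δt * (Θ * B) + Δt * (2 * κ / c) + Δt * (2 * C₁) ≤ 1 := by
    rw [hH] at hHΔ
    linarith
  have p1 : 0 ≤ Δt * (2 * B) := by positivity
  have p2 : 0 ≤ Δt * (Θ * B) := by positivity
  have p3 : 0 ≤ Δt * (2 * κ / c) := by positivity
  have p4 : 0 ≤ Δt * (2 * C₁) := by positivity
  have hsub' : Icc t (t + 2 * Δt) ×ˢ closedBall y 1 ⊆ D :=
    (prod_mono_left (Icc_subset_Icc_right (by linarith))).trans hsub
  obtain ⟨u, hu0, hu⟩ := exists_solution_mem_closedBall hf.continuous (ρ := 1)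
    (B := ⟨B, hB⟩) (K := L) (show t ≤ t + 2 * Δt by linarith) y
    (fun s hs => by
      have := hD.lipschitz.comp (LipschitzWith.prodMk_left s).lipschitzOnWith
        (fun x (hx : x ∈ closedBall y ((1 : NNReal) : ℝ)) => hsub' ⟨hs, hx⟩)
      rwa [mul_one] at this)
    (fun s hs x hx => hD.bound (s, x) (hsub' ⟨hs, hx⟩)) (by
      change B * (t + 2 * Δt - t) ≤ 1
      linarith)
  have huD : SolvesIn f D t (t + 2 * Δt) u := ⟨fun s hs => hsub' (hu.mem s hs), hu.deriv⟩
  have hnear : IsStepNear β f D Θ B t Δt y Y γ u :=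
    ⟨hstep, hΔ, by linarith, by linarith, hsub', hu0, huD⟩
  have hS : c / 2 ≤ ‖lastIncrement β f t Δt Y‖ := by
    have h1 := norm_lastIncrement_sub_le hβ hD hnear
    have h2 : κ * Δt ≤ c / 2 := by
      have : Δt * (2 * κ / c) ≤ 1 := by linarith
      rw [← mul_div_assoc, div_le_one hc] at this
      linarith
    have h3 := norm_sub_norm_le (f t y) (lastIncrement β f t Δt Y)
    rw [norm_sub_rev] at h3
    linarith
  have hγ' := hγ t Δt y Y γ u hnear hS
  have hpow : Δt ^ (N + 1) ≤ Δt := by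
    simpa using pow_le_pow_of_le_one hΔ.le hnear.le_one (show 1 ≤ N + 1 by omega)
  have hγ2 : |γ - 1| ≤ 1 / 2 := by
    have : C₁ * Δt ^ (N + 1) ≤ C₁ * Δt := by gcongr
    linarith
  have q1 : 0 < Δt ^ (N + 1) := by positivity
  have q2 : 0 < Δt ^ (N + 3) := by positivity
  refine ⟨hγ'.trans ?_, hγ2, u, hu0, huD,
    (hY t Δt y Y γ u hnear (by linarith) hγ').trans ?_⟩
  · gcongr; linarith
  · gcongr; linarith

end LocalError

/-! ### Stability of the flow, equilibria and accumulation of local errors. -/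

section GlobalError

variable {E : Type*} [NormedAddCommGroup E] {N : ℕ}

lemma lipschitzOnWith_slice {f : ℝ → E → E} {D : Set (ℝ × E)} {L : NNReal}
    (hL : LipschitzOnWith L (fun p : ℝ × E => f p.1 p.2) D) (s : ℝ) :
    LipschitzOnWith L (f s) {x | (s, x) ∈ D} := by
  have := hL.comp (LipschitzWith.prodMk_left s).lipschitzOnWith
    (fun x (hx : x ∈ {x | (s, x) ∈ D}) => hx)
  rwa [mul_one] at this

section Uniqueness

variable [NormedSpace ℝ E] {f : ℝ → E → E} {D : Set (ℝ × E)} {L : NNReal} {a b : ℝ} {u v : ℝ → E}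

lemma SolvesIn.mono (hu : SolvesIn f D a b u) {a' b' : ℝ} (ha : a ≤ a') (hb : b' ≤ b) :
    SolvesIn f D a' b' u :=
  ⟨fun s hs => hu.mem s (Icc_subset_Icc ha hb hs),
    fun s hs => (hu.deriv s (Icc_subset_Icc ha hb hs)).mono (Icc_subset_Icc ha hb)⟩

lemma SolvesIn.continuousOn (hu : SolvesIn f D a b u) : ContinuousOn u (Icc a b) :=
  HasDerivWithinAt.continuousOn hu.deriv

lemma SolvesIn.hasDerivWithinAt_Ici (hu : SolvesIn f D a b u) {s : ℝ} (hs : s ∈ Ico a b) :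
    HasDerivWithinAt u (f s (u s)) (Ici s) s :=
  (hu.deriv s (Ico_subset_Icc_self hs)).mono_of_mem_nhdsWithin (Icc_mem_nhdsGE_of_mem hs)

lemma SolvesIn.hasDerivWithinAt_Iic (hu : SolvesIn f D a b u) {s : ℝ} (hs : s ∈ Ioc a b) :
    HasDerivWithinAt u (f s (u s)) (Iic s) s :=
  (hu.deriv s (Ioc_subset_Icc_self hs)).mono_of_mem_nhdsWithin (Icc_mem_nhdsLE_of_mem hs)

/-- Continuous dependence on the initial value. -/
theorem SolvesIn.norm_sub_le (hL : LipschitzOnWith L (fun p : ℝ × E => f p.1 p.2) D)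
    (hu : SolvesIn f D a b u) (hv : SolvesIn f D a b v) {s : ℝ} (hs : s ∈ Icc a b) :
    ‖u s - v s‖ ≤ ‖u a - v a‖ * Real.exp (L * (s - a)) := by
  simp only [← dist_eq_norm]
  exact dist_le_of_trajectories_ODE_of_mem (v := f) (s := fun s => {x | (s, x) ∈ D})
    (fun s _ => lipschitzOnWith_slice hL s) hu.continuousOn (fun s hs => hu.hasDerivWithinAt_Ici hs)
    (fun s hs => hu.mem s (Ico_subset_Icc_self hs)) hv.continuousOn
    (fun s hs => hv.hasDerivWithinAt_Ici hs) (fun s hs => hv.mem s (Ico_subset_Icc_self hs))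
    le_rfl s hs

/-- Uniqueness is needed in both time directions, because the zero of `f` on the solution may lie
anywhere in the interval. -/
theorem SolvesIn.eqOn_of_eq (hL : LipschitzOnWith L (fun p : ℝ × E => f p.1 p.2) D)
    (hu : SolvesIn f D a b u) (hv : SolvesIn f D a b v) {c : ℝ} (hc : c ∈ Icc a b)
    (h : u c = v c) : EqOn u v (Icc a b) := by
  have hul := hu.mono le_rfl hc.2
  have hvl := hv.mono le_rfl hc.2
  have hur := hu.mono hc.1 le_rfl
  have hvr := hv.mono hc.1 le_rfl
  intro s hs
  rcases le_total s c with hsc | hsc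
  · exact ODE_solution_unique_of_mem_Icc_left (v := f) (s := fun s => {x | (s, x) ∈ D})
      (fun s _ => lipschitzOnWith_slice hL s) hul.continuousOn
      (fun s hs => hul.hasDerivWithinAt_Iic hs) (fun s hs => hul.mem s (Ioc_subset_Icc_self hs))
      hvl.continuousOn (fun s hs => hvl.hasDerivWithinAt_Iic hs)
      (fun s hs => hvl.mem s (Ioc_subset_Icc_self hs)) h ⟨hs.1, hsc⟩
  · have := hur.norm_sub_le hL hvr (s := s) ⟨hsc, hs.2⟩
    rw [h, sub_self, norm_zero, zero_mul] at this
    exact sub_eq_zero.1 (norm_le_zero_iff.1 this)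

end Uniqueness

variable [InnerProductSpace ℝ E] {f : ℝ → E → E} {β : Fin (N + 2) → ℝ}

lemma exists_isNodes (hβ : StrictMono β) (hβ0 : β 0 = 0) (hβ1 : β (Fin.last (N + 1)) = 1) :
    ∃ Θ, IsNodes β Θ :=
  ⟨∑ m, ∑ r, |theta β r m|, hβ, hβ0, hβ1, fun m =>
    Finset.single_le_sum (f := fun m => ∑ r, |theta β r m|)
      (fun _ _ => Finset.sum_nonneg fun _ _ => abs_nonneg _) (Finset.mem_univ m)⟩

lemma exists_isRegion {D : Set (ℝ × E)} (hD : IsCompact D) (hDconv : Convex ℝ D)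
    (hf : ContDiff ℝ (N + 2 : ℕ) (fun p : ℝ × E => f p.1 p.2)) :
    ∃ B ≥ 0, ∃ L, IsRegion f D B L := by
  obtain ⟨B, hB⟩ := hD.exists_bound_of_continuousOn hf.continuous.continuousOn
  obtain ⟨L, hL⟩ := hf.contDiffOn.exists_lipschitzOnWith (s := D) (by norm_cast) hDconv hD
  exact ⟨max B 0, le_max_right _ _, L, fun p hp => (hB p hp).trans (le_max_left _ _), hL⟩

/-- At an equilibrium the RDeC step does nothing, and it is not relaxed. -/
lemma IsRDeCStep.of_equilibrium {t Δt γ : ℝ} {y : E} {Y : ℕ → Fin (N + 2) → E}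
    (h : IsRDeCStep (N + 2) β f t Δt y Y γ) (hβ : Function.Injective β) (hβ0 : β 0 = 0)
    (hy : ∀ s, f s y = 0) : γ = 1 ∧ Y (N + 2) (Fin.last (N + 1)) = y := by
  have hY : ∀ k ≤ N + 1, ∀ m, Y k m = y := by
    intro k
    induction k with
    | zero => exact fun _ => h.init
    | succ k ih =>
      intro hk m
      rw [h.iterate_succ hβ0 (by omega)]
      simp [ih (by omega), hy]
  constructor
  · apply (h.gamma_spec hβ hβ0).1
    simp [hY (N + 1) le_rfl, hy]
  · rw [h.final_eq hβ0 (Nat.succ_ne_zero N)]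
    simp [hY (N + 1) le_rfl, hy]

/-- Accumulation of local errors of order `p + 1` over a run of a one-step method, as long as the
error remains below `δ`. -/
lemma error_le_of_recursion {t s e : ℕ → ℝ} {t₀ T L C h δ : ℝ} {p n : ℕ}
    (hL : 0 ≤ L) (hC : 0 ≤ C) (ht0 : t 0 = t₀) (he0 : e 0 = 0)
    (hδ : 2 * C * Real.exp (L * (T - t₀)) * (T - t₀) * h ^ p ≤ δ)
    (hs : ∀ n, 0 < s n ∧ s n ≤ h)
    (hrec : ∀ n, t₀ ≤ t n → t n ≤ T → e n ≤ δ → s n / 2 ≤ t (n + 1) - t n ∧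
      (t (n + 1) ≤ T → e (n + 1) ≤ e n * Real.exp (L * (t (n + 1) - t n)) + C * s n ^ (p + 1)))
    (hn : ∀ k ≤ n, t k ≤ T) :
    t₀ ≤ t n ∧ e n ≤ 2 * C * Real.exp (L * (T - t₀)) * (T - t₀) * h ^ p := by
  have hh : 0 < h := (hs 0).1.trans_le (hs 0).2
  have hmono : t₀ ≤ t n → t n ≤ T →
      2 * C * Real.exp (L * (t n - t₀)) * (t n - t₀) * h ^ p ≤
        2 * C * Real.exp (L * (T - t₀)) * (T - t₀) * h ^ p := by
    intro h1 h2
    have : 0 ≤ t n - t₀ := by linarith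
    gcongr
  -- The induction needs the sharper bound with the current time `t n` in place of `T`.
  suffices H : t₀ ≤ t n ∧ e n ≤ 2 * C * Real.exp (L * (t n - t₀)) * (t n - t₀) * h ^ p from
    ⟨H.1, H.2.trans (hmono H.1 (hn n le_rfl))⟩
  clear hmono
  induction n with
  | zero => simp [ht0, he0]
  | succ n ih =>
    obtain ⟨h1, h2⟩ := ih fun k hk => hn k (by omega)
    have hT := hn n (by omega)
    have h0 : 0 ≤ t n - t₀ := by linarith
    have hle : 2 * C * Real.exp (L * (t n - t₀)) * (t n - t₀) * h ^ p ≤ δ := by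
      refine le_trans ?_ hδ
      gcongr
    obtain ⟨h3, h4⟩ := hrec n h1 hT (h2.trans hle)
    have hsn := (hs n).1
    have h5 := h4 (hn (n + 1) le_rfl)
    refine ⟨by linarith, h5.trans ?_⟩
    have hexp : Real.exp (L * (t n - t₀)) * Real.exp (L * (t (n + 1) - t n)) =
        Real.exp (L * (t (n + 1) - t₀)) := by
      rw [← Real.exp_add]; ring_nf
    have hone : 1 ≤ Real.exp (L * (t (n + 1) - t₀)) := by
      rw [← Real.exp_zero]
      exact Real.exp_le_exp.2 (mul_nonneg hL (by linarith))
    -- One factor of the step size is traded for twice the time advance, so that the local errors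
    -- telescope.
    have hsp : C * s n ^ (p + 1) ≤ C * h ^ p * (2 * (t (n + 1) - t n)) := by
      rw [pow_succ, ← mul_assoc]
      have := (hs n).2
      gcongr
      linarith
    have hd : 0 ≤ C * h ^ p * (2 * (t (n + 1) - t n)) := by
      have : 0 ≤ t (n + 1) - t n := by linarith
      positivity
    calc e n * Real.exp (L * (t (n + 1) - t n)) + C * s n ^ (p + 1)
        ≤ 2 * C * Real.exp (L * (t n - t₀)) * (t n - t₀) * h ^ p *
            Real.exp (L * (t (n + 1) - t n)) +
            Real.exp (L * (t (n + 1) - t₀)) * (C * h ^ p * (2 * (t (n + 1) - t n))) := by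
          refine add_le_add (by gcongr) (hsp.trans ?_)
          exact le_mul_of_one_le_left hd hone
      _ = 2 * C * Real.exp (L * (t (n + 1) - t₀)) * (t (n + 1) - t₀) * h ^ p := by
          rw [← hexp]; ring

/-- Error propagation in one step of the RDeC method, near a solution along which `f` does not
vanish. -/
theorem exists_error_recursion [FiniteDimensional ℝ E] (hβ : StrictMono β) (hβ0 : β 0 = 0)
    (hβ1 : β (Fin.last (N + 1)) = 1)
    (hf : ContDiff ℝ (N + 2 : ℕ) (fun p : ℝ × E => f p.1 p.2)) {t₀ T : ℝ} (hT : t₀ ≤ T)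
    {sol : ℝ → E}
    (hsol : ∀ t ∈ Icc t₀ T, HasDerivWithinAt sol (f t (sol t)) (Icc t₀ T) t)
    (hne : ∀ t ∈ Icc t₀ T, f t (sol t) ≠ 0) :
    ∃ C > 0, ∃ h₀ > 0, ∃ δ > 0, ∃ L ≥ 0, ∀ t ∈ Icc t₀ T, ∀ y, ‖y - sol t‖ ≤ δ →
      ∀ Δt, 0 < Δt → Δt ≤ h₀ → ∀ Y γ, IsRDeCStep (N + 2) β f t Δt y Y γ →
        |γ - 1| ≤ C * Δt ^ (N + 1) ∧ |γ - 1| ≤ 1 / 2 ∧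
        (t + γ * Δt ≤ T → ‖Y (N + 2) (Fin.last (N + 1)) - sol (t + γ * Δt)‖ ≤
          ‖y - sol t‖ * Real.exp (L * (γ * Δt)) + C * Δt ^ (N + 3)) := by
  have : CompleteSpace E := FiniteDimensional.complete ℝ E
  have hcont : ContinuousOn sol (Icc t₀ T) := HasDerivWithinAt.continuousOn hsol
  obtain ⟨R, hR⟩ := isCompact_Icc.exists_bound_of_continuousOn hcont
  -- One unit of the radius allows for the numerical error, the other for the unit ball around the
  -- numerical value; `T + 1` leaves room for a step started near `T`.
  set D : Set (ℝ × E) := Icc t₀ (T + 1) ×ˢ closedBall 0 (R + 2) with hDdef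
  have : ProperSpace E := FiniteDimensional.proper ℝ E
  have hDc : IsCompact D := isCompact_Icc.prod (isCompact_closedBall _ _)
  have hDconv : Convex ℝ D := (convex_Icc _ _).prod (convex_closedBall _ _)
  obtain ⟨B, hB, L, hD⟩ := exists_isRegion hDc hDconv hf
  obtain ⟨Θ, hΘ⟩ := exists_isNodes hβ hβ0 hβ1
  have hsolD : SolvesIn f D t₀ T sol := by
    refine ⟨fun s hs => ⟨⟨hs.1, by linarith [hs.2]⟩, ?_⟩, hsol⟩
    rw [mem_closedBall_zero_iff]
    linarith [hR s hs]
  have hfcont : ContinuousOn (fun t => ‖f t (sol t)‖) (Icc t₀ T) :=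
    (hf.continuous.comp_continuousOn (continuousOn_id.prodMk hcont)).norm
  obtain ⟨τ, hτ, hmin⟩ := isCompact_Icc.exists_isMinOn ⟨t₀, left_mem_Icc.2 hT⟩ hfcont
  set c := ‖f τ (sol τ)‖ with hc
  have hc0 : 0 < c := norm_pos_iff.2 (hne τ hτ)
  obtain ⟨C, hC, h₀, hh₀, hloc⟩ := exists_local_error_bound hΘ hD hDc hDconv hB hf (half_pos hc0)
  have hL1 : (0 : ℝ) < L + 1 := by positivity
  -- The second entry of the minimum keeps `‖f t y‖ ≥ c / 2` by Lipschitz continuity; `L + 1` avoids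
  -- division by zero.
  refine ⟨C, hC, h₀, hh₀, min 1 (c / 2 / (L + 1)), by positivity, L, L.2,
    fun t ht y hy Δt hΔ hΔh Y γ hstep => ?_⟩
  have hy1 : ‖y - sol t‖ ≤ 1 := hy.trans (min_le_left _ _)
  have hy2 : ‖y - sol t‖ * (L + 1) ≤ c / 2 := by
    rw [← le_div_iff₀ hL1]
    exact hy.trans (min_le_right _ _)
  have hyR : ‖y‖ ≤ R + 1 := by
    have := norm_le_norm_add_norm_sub' y (sol t)
    linarith [hR t ht]
  have hsub : Icc t (t + 1) ×ˢ closedBall y 1 ⊆ D := by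
    refine prod_mono (Icc_subset_Icc ht.1 (by linarith [ht.2])) (closedBall_subset_closedBall' ?_)
    rw [dist_zero_right]
    linarith
  have hfy : c / 2 ≤ ‖f t y‖ := by
    have h1 : ‖f t y - f t (sol t)‖ ≤ L * ‖y - sol t‖ := by
      have := (lipschitzOnWith_slice hD.lipschitz t).norm_sub_le
        (hsub ⟨⟨le_rfl, by linarith⟩, mem_closedBall_self zero_le_one⟩ : (t, y) ∈ D)
        (hsolD.mem t ht)
      exact this
    have h2 : c ≤ ‖f t (sol t)‖ := hmin ht
    have h3 := norm_sub_norm_le (f t (sol t)) (f t y)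
    rw [norm_sub_rev] at h3
    nlinarith [norm_nonneg (y - sol t)]
  obtain ⟨hγ, hγ2, u, hu0, hu, hY⟩ := hloc t y hsub hfy Δt hΔ hΔh Y γ hstep
  refine ⟨hγ, hγ2, fun hle => ?_⟩
  obtain ⟨g1, g2⟩ := abs_le.1 hγ2
  have hst := (hu.mono (le_refl t) (by nlinarith : t + γ * Δt ≤ t + 2 * Δt)).norm_sub_le
    hD.lipschitz (hsolD.mono ht.1 hle) (s := t + γ * Δt) ⟨by nlinarith, le_rfl⟩
  rw [hu0, add_sub_cancel_left] at hst
  have := norm_sub_le_norm_sub_add_norm_sub (Y (N + 2) (Fin.last (N + 1))) (u (t + γ * Δt))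
    (sol (t + γ * Δt))
  linarith

end GlobalError

end RDeC

end

/-! ### The convergence theorem. -/

theorem theorem2 {E : Type*} [NormedAddCommGroup E] [InnerProductSpace ℝ E]
    [FiniteDimensional ℝ E]
    (d M : ℕ) (hd : 1 < d) (hM : d = M + 1)
    (β : Fin (M + 1) → ℝ) (hβ : StrictMono β) (hβ0 : β 0 = 0) (hβ1 : β (Fin.last M) = 1)
    (f : ℝ → E → E) (hf : ContDiff ℝ d (fun p : ℝ × E => f p.1 p.2))
    (t₀ T : ℝ) (ht : t₀ < T) (y₀ : E) (sol : ℝ → E) (hsol₀ : sol t₀ = y₀)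
    (hsol : ∀ t ∈ Set.Icc t₀ T, HasDerivWithinAt sol (f t (sol t)) (Set.Icc t₀ T) t)
    (hreg : (∀ s t x, f s x = f t x) ∨ ∀ t ∈ Set.Icc t₀ T, f t (sol t) ≠ 0) :
    ∃ C > 0, ∃ h₀ > 0,
      -- one step from an exact value: the local error is of order `d + 1`
      (∀ t ∈ Set.Icc t₀ T, ∀ Δt, 0 < Δt → Δt ≤ h₀ → ∀ (Y : ℕ → Fin (M + 1) → E) (γ : ℝ),
        RDeC.IsRDeCStep d β f t Δt (sol t) Y γ →
          |γ - 1| ≤ C * Δt ^ (d - 1) ∧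
          (t + γ * Δt ≤ T → ‖Y d (Fin.last M) - sol (t + γ * Δt)‖ ≤ C * Δt ^ (d + 1))) ∧
      -- many steps, of sizes at most `h`: the global error is of order `d`
      (∀ h, 0 < h → h ≤ h₀ → ∀ (Δt t γ : ℕ → ℝ) (y : ℕ → E),
        (∀ n, 0 < Δt n ∧ Δt n ≤ h) → RDeC.IsRDeCRun d β f t₀ y₀ Δt t γ y →
          ∀ n, (∀ k ≤ n, t k ≤ T) →
            |γ n - 1| ≤ C * Δt n ^ (d - 1) ∧ ‖y n - sol (t n)‖ ≤ C * h ^ d) := by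
  obtain ⟨N, rfl⟩ : ∃ N, M = N + 1 := ⟨M - 1, by omega⟩
  subst hM
  change ContDiff ℝ (N + 2 : ℕ) _ at hf
  -- The split is on vanishing along the solution: an autonomous `f` without zeros there belongs to
  -- the main case.
  by_cases hne : ∀ t ∈ Set.Icc t₀ T, f t (sol t) ≠ 0
  · obtain ⟨C, hC, h₀, hh₀, δ, hδ, L, hL, hrec⟩ :=
      RDeC.exists_error_recursion hβ hβ0 hβ1 hf ht.le hsol hne
    have hTt : 0 < T - t₀ := sub_pos.2 ht
    set C₂ := 2 * C * Real.exp (L * (T - t₀)) * (T - t₀) with hC₂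
    have hC₂0 : 0 < C₂ := by positivity
    refine ⟨C + C₂, by positivity, min h₀ (min 1 (δ / C₂)), by positivity, ?_, ?_⟩
    · intro t htT Δt hΔ hΔh Y γ hstep
      obtain ⟨h1, -, h2⟩ := hrec t htT (sol t) (by simpa using hδ.le) Δt hΔ
        (hΔh.trans (min_le_left _ _)) Y γ hstep
      refine ⟨h1.trans ?_, fun hle => (h2 hle).trans ?_⟩
      · rw [Nat.add_sub_cancel]
        gcongr
        linarith
      · rw [sub_self, norm_zero, zero_mul, zero_add]
        gcongr
        linarith
    · intro h hh hhh Δt t γ y hΔ ⟨ht0, hy0, hrun⟩ n hn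
      have hh1 : h ≤ 1 := hhh.trans ((min_le_right _ _).trans (min_le_left _ _))
      have hh2 : h ≤ δ / C₂ := hhh.trans ((min_le_right _ _).trans (min_le_right _ _))
      have hhδ : C₂ * h ^ (N + 2) ≤ δ := by
        have h1 : h ^ (N + 2) ≤ h := by
          simpa using pow_le_pow_of_le_one hh.le hh1 (show 1 ≤ N + 2 by omega)
        rw [le_div_iff₀ hC₂0] at hh2
        nlinarith
      have hstep : ∀ n, t₀ ≤ t n → t n ≤ T → ‖y n - sol (t n)‖ ≤ δ →
          |γ n - 1| ≤ C * Δt n ^ (N + 1) ∧ |γ n - 1| ≤ 1 / 2 ∧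
          (t (n + 1) ≤ T → ‖y (n + 1) - sol (t (n + 1))‖ ≤
            ‖y n - sol (t n)‖ * Real.exp (L * (t (n + 1) - t n)) + C * Δt n ^ (N + 3)) := by
        intro n h1 h2 h3
        obtain ⟨htn, Y, hY, hyn⟩ := hrun n
        obtain ⟨g1, g2, g3⟩ := hrec (t n) ⟨h1, h2⟩ (y n) h3 (Δt n) (hΔ n).1
          ((hΔ n).2.trans (hhh.trans (min_le_left _ _))) Y (γ n) hY
        refine ⟨g1, g2, fun h4 => ?_⟩
        rw [hyn, htn, add_sub_cancel_left]
        exact g3 (htn ▸ h4)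
      obtain ⟨h1, h2⟩ := RDeC.error_le_of_recursion (t := t) (s := Δt)
        (e := fun n => ‖y n - sol (t n)‖) (p := N + 2) (δ := δ) hL hC.le ht0
        (by simp [ht0, hy0, hsol₀]) hhδ hΔ
        (fun n h1 h2 h3 => by
          obtain ⟨-, g2, g3⟩ := hstep n h1 h2 h3
          refine ⟨?_, g3⟩
          rw [(hrun n).1, add_sub_cancel_left]
          have := (abs_le.1 g2).1
          have := (hΔ n).1
          nlinarith) hn
      refine ⟨(hstep n h1 (hn n le_rfl) (h2.trans hhδ)).1.trans ?_, h2.trans ?_⟩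
      · rw [Nat.add_sub_cancel]
        have := (hΔ n).1
        gcongr
        linarith
      · change C₂ * h ^ (N + 2) ≤ _
        gcongr
        linarith
  · have haut : ∀ s t x, f s x = f t x := hreg.resolve_right hne
    push Not at hne
    obtain ⟨τ, hτ, hfτ⟩ := hne
    obtain ⟨R, hR⟩ := isCompact_Icc.exists_bound_of_continuousOn
      (HasDerivWithinAt.continuousOn hsol)
    have : ProperSpace E := FiniteDimensional.proper ℝ E
    obtain ⟨B, -, L, hD⟩ := RDeC.exists_isRegion
      (isCompact_Icc.prod (isCompact_closedBall 0 R))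
      ((convex_Icc t₀ T).prod (convex_closedBall (0 : E) R)) hf
    -- As `f` is autonomous, its zero at `sol τ` persists for all times, so the constant function is
    -- a solution too.
    have hconst : Set.EqOn sol (fun _ => sol τ) (Set.Icc t₀ T) := by
      refine RDeC.SolvesIn.eqOn_of_eq hD.lipschitz
        ⟨fun s hs => ⟨hs, mem_closedBall_zero_iff.2 (hR s hs)⟩, hsol⟩
        ⟨fun s hs => ⟨hs, mem_closedBall_zero_iff.2 (hR τ hτ)⟩, fun s hs => ?_⟩ hτ rfl
      rw [haut s τ, hfτ]
      exact hasDerivWithinAt_const _ _ _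
    have hy₀ : sol τ = y₀ := hsol₀ ▸ (hconst (Set.left_mem_Icc.2 ht.le)).symm
    have hsoly : ∀ s ∈ Set.Icc t₀ T, sol s = y₀ := fun s hs => (hconst hs).trans hy₀
    have hzero : ∀ s, f s y₀ = 0 := fun s => by rw [haut s τ, ← hy₀, hfτ]
    refine ⟨1, one_pos, 1, one_pos, ?_, ?_⟩
    · intro t htT Δt hΔ _ Y γ hstep
      rw [hsoly t htT] at hstep
      obtain ⟨h1, h2⟩ := hstep.of_equilibrium hβ.injective hβ0 hzero
      refine ⟨by rw [h1, sub_self, abs_zero]; positivity, fun hle => ?_⟩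
      have hmem : t + γ * Δt ∈ Set.Icc t₀ T := by
        refine ⟨?_, hle⟩
        rw [h1]
        linarith [htT.1]
      change ‖Y (N + 2) _ - _‖ ≤ _
      rw [h2, hsoly _ hmem, sub_self, norm_zero]
      positivity
    · intro h hh _ Δt t γ y hΔ ⟨ht0, hy0, hrun⟩ n hn
      have hy : ∀ n, y n = y₀ := by
        intro n
        induction n with
        | zero => exact hy0
        | succ n ih =>
          obtain ⟨-, Y, hY, hyn⟩ := hrun n
          rw [ih] at hY
          rw [hyn]
          exact (hY.of_equilibrium hβ.injective hβ0 hzero).2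
      have hγ : ∀ n, γ n = 1 := by
        intro n
        obtain ⟨-, Y, hY, -⟩ := hrun n
        rw [hy n] at hY
        exact (hY.of_equilibrium hβ.injective hβ0 hzero).1
      have htn : ∀ n, t₀ ≤ t n := by
        intro n
        induction n with
        | zero => exact ht0.ge
        | succ n ih =>
          rw [(hrun n).1, hγ n]
          linarith [(hΔ n).1]
      have := (hΔ n).1
      refine ⟨by rw [hγ n, sub_self, abs_zero]; positivity, ?_⟩
      rw [hy n, hsoly _ ⟨htn n, hn n le_rfl⟩, sub_self, norm_zero]
      positivity
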